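/- Let $T,d\in\mathbb N_0$, let $(\Omega,\mathcal F,(\mathcal F_t)_{t\in\{0,\dots,T\}},P)$ be a filtered probability space with $\mathcal F_0$ $P$-trivial and $\mathcal F_T=\mathcal F$, and let $X=(X_t)_{t\in\{0,\dots,T\}}$ be an adapted $\mathbb R^d$-valued process (the discounted prices). Let $\mathrm{Pred}$ denote the set of $d$-dimensional predictable processes $\xi=(\xi_1,\dots,\xi_T)$ ($\xi_k$ is $\mathcal F_{k-1}$-measurable), and set $(\xi\cdot X)_t=\sum_{k=1}^t\xi_k\,(X_k-X_{k-1})$ and $G_t(\xi)=(\xi\cdot X)_T-(\xi\cdot X)_t$. A market is called free of arbitrage if there is no predictable $\xi$ with $(\xi\cdot X)_T\ge 0$ $P$-a.s. and $P((\xi\cdot X)_T>0)>0$; assume that the market $X$ is free of arbitrage. Let $t\in\{0,\dots,T\}$ and let $H\in L^0_+(\mathcal F_T)$ be a European contingent claim, i.e. a $P$-a.s. nonnegative real random variable. * $H$ is *attainable at time $t$* if $H=H_t+G_t(\xi)$ $P$-a.s. for some $\xi\in\mathrm{Pred}$ and some (real-valued) $H_t\in L^0(\mathcal F_t)$. * $\pi_t\in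 L^0(\mathcal F_t)$ is an *arbitrage-free price of $H$ at time $t$* if there is an adapted real process $X^{d+1}$ with $X^{d+1}_t=\pi_t$ and $X^{d+1}_T=H$ $P$-a.s. such that the extended market $(X,X^{d+1})$ is free of arbitrage. Let $\Pi_t(H)$ be the set of all arbitrage-free prices of $H$ at time $t$. * $\pi^{\inf}_t(H):=\operatorname{ess\,inf}\Pi_t(H)$ and $\pi^{\sup}_t(H):=\operatorname{ess\,sup}\Pi_t(H)$, as extended real-valued random variables. Then the following hold. 1. $H$ is attainable at time $t$ if and only if $\pi^{\inf}_t(H)=\pi^{\sup}_t(H)$ $P$-a.s. 2. $H$ is attainable at time $t$ if and only if there is a unique (up to $P$-null sets) arbitrage-free price of $H$ at time $t$. 3. If $H$ is not attainable at time $t$, then neither $\pi^{\inf}_t(H)$ nor $\pi^{\sup}_t(H)$ is ($P$-a.s. equal to) an arbitrage-free price of $H$ at time $t$. -/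

import Mathlib

open MeasureTheory

namespace CondPricing

noncomputable section

/-! ### Essential supremum and infimum of a family of extended real random variables -/

section EssBounds

variable {Ω : Type*} {m : MeasurableSpace Ω}

/-- `g` is an essential supremum of the family `Φ`: the smallest random variable (up to null sets)
that dominates each member of `Φ` almost surely. -/
structure IsEssSup (P : Measure Ω) (Φ : Set (Ω → EReal)) (g : Ω → EReal) : Prop where
  measurable : Measurable g
  le : ∀ f ∈ Φ, f ≤ᵐ[P] g
  least : ∀ g' : Ω → EReal, Measurable g' → (∀ f ∈ Φ, f ≤ᵐ[P] g') → g ≤ᵐ[P] g'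

/-- `g` is an essential infimum of the family `Φ`: the largest random variable (up to null sets)
that is dominated by each member of `Φ` almost surely. -/
structure IsEssInf (P : Measure Ω) (Φ : Set (Ω → EReal)) (g : Ω → EReal) : Prop where
  measurable : Measurable g
  le : ∀ f ∈ Φ, g ≤ᵐ[P] f
  greatest : ∀ g' : Ω → EReal, Measurable g' → (∀ f ∈ Φ, g' ≤ᵐ[P] f) → g' ≤ᵐ[P] g

theorem exists_isEssSup (P : Measure Ω) [IsFiniteMeasure P] (Φ : Set (Ω → EReal)) :
    ∃ g, IsEssSup P Φ g := by
  let U : Set (Ω → EReal) := {g | Measurable g ∧ ∀ f ∈ Φ, f ≤ᵐ[P] g}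
  let φ : EReal → ENNReal := fun x => (1 + EReal.exp x)⁻¹
  have hφm : Measurable φ := (measurable_const.add EReal.measurable_exp).inv
  have hφa : Antitone φ := fun x y h => by
    have := EReal.exp_strictMono.monotone h
    simp only [φ]
    gcongr
  have hφi : Function.Injective φ := fun x y h => by
    have h1 := inv_injective h
    exact EReal.exp_strictMono.injective
      ((ENNReal.add_right_inj ENNReal.one_ne_top).1 h1)
  have hφ1 : ∀ x, φ x ≤ 1 := fun x => by
    simp only [φ]
    exact ENNReal.inv_le_one.2 le_self_add
  let I : (Ω → EReal) → ENNReal := fun g => ∫⁻ ω, φ (g ω) ∂P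
  have hIfin : ∀ g, I g ≠ ⊤ := fun g => by
    have h : I g ≤ ∫⁻ _, 1 ∂P := lintegral_mono fun ω => hφ1 (g ω)
    rw [lintegral_one] at h
    exact ne_top_of_le_ne_top (measure_ne_top P _) h
  have hU : (I '' U).Nonempty :=
    ⟨_, fun _ => ⊤, ⟨measurable_const, fun f _ => Filter.Eventually.of_forall fun _ => le_top⟩, rfl⟩
  obtain ⟨u, -, hulim, huU⟩ := exists_seq_tendsto_sSup hU (OrderTop.bddAbove _)
  choose G hGU hGI using huU
  let g : Ω → EReal := fun ω => ⨅ n, G n ω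
  have hgU : g ∈ U := by
    refine ⟨Measurable.iInf fun n => (hGU n).1, fun f hf => ?_⟩
    filter_upwards [ae_all_iff.2 fun n => (hGU n).2 f hf] with ω hω
    exact le_iInf hω
  have hgI : sSup (I '' U) ≤ I g := by
    refine le_of_tendsto' hulim fun n => ?_
    rw [← hGI n]
    exact lintegral_mono fun ω => hφa (iInf_le _ n)
  refine ⟨g, hgU.1, hgU.2, fun g' hg'm hg' => ?_⟩
  have hmin : (fun ω => min (g ω) (g' ω)) ∈ U := by
    refine ⟨hgU.1.min hg'm, fun f hf => ?_⟩
    filter_upwards [hgU.2 f hf, hg' f hf] with ω h1 h2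
    exact le_min h1 h2
  have hle : I (fun ω => min (g ω) (g' ω)) ≤ I g :=
    (le_sSup (Set.mem_image_of_mem I hmin)).trans hgI
  have hae := ae_eq_of_ae_le_of_lintegral_le (μ := P) (f := fun ω => φ (g ω))
    (g := fun ω => φ (min (g ω) (g' ω)))
    (Filter.Eventually.of_forall fun ω => hφa (min_le_left _ _)) (hIfin g)
    (hφm.comp hmin.1).aemeasurable hle
  filter_upwards [hae] with ω hω
  exact left_eq_inf.1 (hφi hω)

/-- The essential supremum of a family of random variables (unique up to null sets). -/
def essSupFamily (P : Measure Ω) [IsFiniteMeasure P] (Φ : Set (Ω → EReal)) : Ω → EReal :=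
  (exists_isEssSup P Φ).choose

/-- The essential infimum of a family of random variables, `essinf Φ = - esssup (-Φ)`. -/
def essInfFamily (P : Measure Ω) [IsFiniteMeasure P] (Φ : Set (Ω → EReal)) : Ω → EReal :=
  fun ω => - essSupFamily P ((fun f ω => - f ω) '' Φ) ω

theorem isEssSup_essSupFamily (P : Measure Ω) [IsFiniteMeasure P] (Φ : Set (Ω → EReal)) :
    IsEssSup P Φ (essSupFamily P Φ) :=
  (exists_isEssSup P Φ).choose_spec

theorem isEssInf_essInfFamily (P : Measure Ω) [IsFiniteMeasure P] (Φ : Set (Ω → EReal)) :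
    IsEssInf P Φ (essInfFamily P Φ) := by
  have h := isEssSup_essSupFamily P ((fun f ω => - f ω) '' Φ)
  refine ⟨h.measurable.neg, fun f hf => ?_, fun g' hg'm hg' => ?_⟩
  · filter_upwards [h.le _ ⟨f, hf, rfl⟩] with ω hω
    exact EReal.neg_le.1 hω
  · have := h.least (fun ω => - g' ω) hg'm.neg (by
      rintro _ ⟨f, hf, rfl⟩
      filter_upwards [hg' f hf] with ω hω
      exact EReal.neg_le_neg_iff.2 hω)
    filter_upwards [this] with ω hω
    exact EReal.le_neg_of_le_neg hω

end EssBounds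

/-! ### The market in discrete time `{0, …, T}` -/

section Market

variable {Ω : Type*} {m : MeasurableSpace Ω} {T d : ℕ}

/-- A `d`-dimensional predictable process `(ξ₁, …, ξ_T)`. The index `k : Fin T` stands for
the trading period from time `k` to time `k + 1`, so `ξ k` is the holding `ξ_{k+1}` and has to be
known at time `k`. -/
def IsPredictable (ℱ : Filtration (Fin (T + 1)) m) (ξ : Fin T → Ω → (Fin d → ℝ)) : Prop :=
  ∀ k : Fin T, Measurable[ℱ k.castSucc] (ξ k)

/-- The gains `(ξ · X)_t = ∑_{k=1}^t ξ_k (X_k - X_{k-1})` from trading until time `t`. -/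
def gains (X : Fin (T + 1) → Ω → (Fin d → ℝ)) (ξ : Fin T → Ω → (Fin d → ℝ))
    (t : Fin (T + 1)) (ω : Ω) : ℝ :=
  ∑ k : Fin T with k.succ ≤ t, ξ k ω ⬝ᵥ (X k.succ ω - X k.castSucc ω)

/-- The gains `G_t(ξ) = (ξ · X)_T - (ξ · X)_t` from trading after time `t`. -/
def gainsAfter (X : Fin (T + 1) → Ω → (Fin d → ℝ)) (t : Fin (T + 1))
    (ξ : Fin T → Ω → (Fin d → ℝ)) (ω : Ω) : ℝ :=
  gains X ξ (Fin.last T) ω - gains X ξ t ω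

/-- The market with (discounted) prices `X` is free of arbitrage: no self-financing strategy has
a terminal gain that is almost surely nonnegative and positive with positive probability. -/
def IsArbitrageFree (P : Measure Ω) (ℱ : Filtration (Fin (T + 1)) m)
    (X : Fin (T + 1) → Ω → (Fin d → ℝ)) : Prop :=
  ¬ ∃ ξ : Fin T → Ω → (Fin d → ℝ), IsPredictable ℱ ξ ∧
    (∀ᵐ ω ∂P, 0 ≤ gains X ξ (Fin.last T) ω) ∧
    0 < P {ω | 0 < gains X ξ (Fin.last T) ω}

/-- The claim `H` is attainable (replicable) at time `t`. -/
def IsAttainable (P : Measure Ω) (ℱ : Filtration (Fin (T + 1)) m)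
    (X : Fin (T + 1) → Ω → (Fin d → ℝ)) (t : Fin (T + 1)) (H : Ω → ℝ) : Prop :=
  ∃ (ξ : Fin T → Ω → (Fin d → ℝ)) (Ht : Ω → ℝ), IsPredictable ℱ ξ ∧ Measurable[ℱ t] Ht ∧
    ∀ᵐ ω ∂P, H ω = Ht ω + gainsAfter X t ξ ω

/-- The market `(X, Y)` obtained by adding the security with price process `Y`. -/
def extendMarket (X : Fin (T + 1) → Ω → (Fin d → ℝ)) (Y : Fin (T + 1) → Ω → ℝ) :
    Fin (T + 1) → Ω → (Fin (d + 1) → ℝ) :=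
  fun s ω => Fin.snoc (X s ω) (Y s ω)

/-- The set `Π_t(H)` of arbitrage-free prices of `H` at time `t`. -/
def arbitrageFreePrices (P : Measure Ω) (ℱ : Filtration (Fin (T + 1)) m)
    (X : Fin (T + 1) → Ω → (Fin d → ℝ)) (t : Fin (T + 1)) (H : Ω → ℝ) : Set (Ω → ℝ) :=
  {p | Measurable[ℱ t] p ∧ ∃ Y : Fin (T + 1) → Ω → ℝ, (∀ s, Measurable[ℱ s] (Y s)) ∧
    Y t =ᵐ[P] p ∧ Y (Fin.last T) =ᵐ[P] H ∧ IsArbitrageFree P ℱ (extendMarket X Y)}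

/-- The upper bound `π^sup_t(H) = esssup Π_t(H)`. -/
def priceSup (P : Measure Ω) [IsFiniteMeasure P] (ℱ : Filtration (Fin (T + 1)) m)
    (X : Fin (T + 1) → Ω → (Fin d → ℝ)) (t : Fin (T + 1)) (H : Ω → ℝ) : Ω → EReal :=
  essSupFamily P ((fun p ω => (p ω : EReal)) '' arbitrageFreePrices P ℱ X t H)

/-- The lower bound `π^inf_t(H) = essinf Π_t(H)`. -/
def priceInf (P : Measure Ω) [IsFiniteMeasure P] (ℱ : Filtration (Fin (T + 1)) m)
    (X : Fin (T + 1) → Ω → (Fin d → ℝ)) (t : Fin (T + 1)) (H : Ω → ℝ) : Ω → EReal :=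
  essInfFamily P ((fun p ω => (p ω : EReal)) '' arbitrageFreePrices P ℱ X t H)

/-- The extended real random variable `b` is (almost surely equal to) an arbitrage-free price. -/
def IsArbitrageFreePrice (P : Measure Ω) (ℱ : Filtration (Fin (T + 1)) m)
    (X : Fin (T + 1) → Ω → (Fin d → ℝ)) (t : Fin (T + 1)) (H : Ω → ℝ) (b : Ω → EReal) : Prop :=
  ∃ p ∈ arbitrageFreePrices P ℱ X t H, (fun ω => (p ω : EReal)) =ᵐ[P] b

end Market

end

end CondPricing

/-! Everything rests on two facts. The law of one price (`eq_of_replicating_strategy`) makes all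
arbitrage-free prices of an attainable claim agree. Conversely, if the claim is not attainable, each
arbitrage-free price can be replaced by one that is almost surely no larger and not almost surely
equal (`exists_arbitrageFreePrice_lt`); passing to `-H` also raises it. Hence neither bound can be a
price, and with existence of prices the equivalences follow.

Absence of arbitrage is a one-period condition, so prices can be changed one date at a time. If
every increment of a price process `Y` of the claim after `t` were replicable, the strategies would
combine into a replication. So some period at or after `t` is not replicable. There an Esscher-type
change of measure gives the increment a negative conditional value on some event, and the price at
the start of the period drops (`OneStepNA.exists_price_lt_of_not_replicable`). Conditional
expectation under a martingale measure for the original extended market preserves the order and the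
inequality, which carries the drop back to `t`; prices before `t` are chosen afresh.

The measures come from minimising `𝔼[exp (-ξ · Δ)]`. The minimum is attained because gains bounded
below have a gain among their pointwise cluster points (`OneStepNA.exists_clusterPt`). -/

open Filter Topology

namespace CondPricing

/-! ### Measurable selection of cluster points -/

section Selection

variable {Ω : Type*} {mΩ : MeasurableSpace Ω}

theorem measurable_randomIndex {β : Type*} [MeasurableSpace β] {f : ℕ → Ω → β}
    (hf : ∀ n, Measurable (f n)) {σ : Ω → ℕ} (hσ : Measurable σ) :
    Measurable fun ω => f (σ ω) ω := by
  have h : Measurable (fun p : ℕ × Ω => f p.1 p.2) := measurable_from_prod_countable_right hf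
  exact h.comp (hσ.prodMk measurable_id)

/-- A bounded sequence of random variables converges along a measurable random subsequence. -/
theorem exists_randomIndex_tendsto {u : ℕ → Ω → ℝ} (hu : ∀ n, Measurable (u n))
    (hb : ∀ ω, ∃ C, ∀ n, |u n ω| ≤ C) :
    ∃ σ : ℕ → Ω → ℕ, (∀ k, Measurable (σ k)) ∧ (∀ k ω, k ≤ σ k ω) ∧
      ∀ ω, ∃ l, Tendsto (fun k => u (σ k ω) ω) atTop (𝓝 l) := by
  classical
  -- The limsup is a measurable target that is approached infinitely often, so first hitting times
  -- of its shrinking neighbourhoods are measurable indices.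
  let l : Ω → ℝ := fun ω => limsup (fun n => u n ω) atTop
  have hl : Measurable l := Measurable.limsup hu
  have hex : ∀ (k : ℕ) (ω : Ω), ∃ n, k ≤ n ∧ |u n ω - l ω| < 1 / ((k : ℝ) + 1) := by
    intro k ω
    have hk : 0 < 1 / ((k : ℝ) + 1) := by positivity
    obtain ⟨C, hC⟩ := hb ω
    have hbdd : IsBoundedUnder (· ≤ ·) atTop fun n => u n ω :=
      isBoundedUnder_of ⟨C, fun n => (abs_le.1 (hC n)).2⟩
    have hcob : IsCoboundedUnder (· ≤ ·) atTop fun n => u n ω :=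
      (isBoundedUnder_of ⟨-C, fun n => (abs_le.1 (hC n)).1⟩ :
        IsBoundedUnder (· ≥ ·) atTop fun n => u n ω).isCoboundedUnder_flip
    have h1 : ∃ᶠ n in atTop, l ω - 1 / ((k : ℝ) + 1) < u n ω :=
      frequently_lt_of_lt_limsup hcob (by simp only [l]; linarith)
    have h2 : ∀ᶠ n in atTop, u n ω < l ω + 1 / ((k : ℝ) + 1) :=
      eventually_lt_of_limsup_lt (by simp only [l]; linarith) hbdd
    obtain ⟨n, h3, h4, h5⟩ := (h1.and_eventually (h2.and (eventually_ge_atTop k))).exists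
    exact ⟨n, h5, abs_lt.2 ⟨by linarith, by linarith⟩⟩
  refine ⟨fun k ω => Nat.find (hex k ω), fun k => ?_, fun k ω => (Nat.find_spec (hex k ω)).1,
    fun ω => ⟨l ω, ?_⟩⟩
  · refine measurable_find _ fun n => ?_
    by_cases hkn : k ≤ n
    · simp only [hkn, true_and]
      exact measurableSet_lt ((hu n).sub hl).abs measurable_const
    · simp [hkn]
  · rw [tendsto_iff_norm_sub_tendsto_zero]
    refine squeeze_zero (fun _ => norm_nonneg _)
      (fun k => (Nat.find_spec (hex k ω)).2.le) tendsto_one_div_add_atTop_nhds_zero_nat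

variable {ι : Type*} [Fintype ι]

/-- Bolzano–Weierstrass one coordinate at a time: a further random subsequence keeps the limits
already obtained. The indices need only tend to infinity, not increase. -/
theorem exists_measurable_subseq_tendsto_of_bounded {v : ℕ → Ω → (ι → ℝ)}
    (hv : ∀ n, Measurable (v n)) (hb : ∀ ω, ∃ C, ∀ n, ‖v n ω‖ ≤ C) (s : Finset ι) :
    ∃ w : ℕ → Ω → (ι → ℝ), (∀ n, Measurable (w n)) ∧
      (∀ ω, ∃ φ : ℕ → ℕ, Tendsto φ atTop atTop ∧ ∀ k, w k ω = v (φ k) ω) ∧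
      ∀ ω, ∀ i ∈ s, ∃ l, Tendsto (fun k => w k ω i) atTop (𝓝 l) := by
  classical
  induction s using Finset.induction_on with
  | empty => exact ⟨v, hv, fun ω => ⟨id, tendsto_id, fun _ => rfl⟩, by simp⟩
  | insert j s _ ih =>
    obtain ⟨w, hw, hsub, hlim⟩ := ih
    have hwb : ∀ ω, ∃ C, ∀ n, |w n ω j| ≤ C := fun ω => by
      obtain ⟨C, hC⟩ := hb ω
      obtain ⟨φ, -, hφ⟩ := hsub ω
      exact ⟨C, fun n => by
        have := (norm_le_pi_norm (w n ω) j).trans ((hφ n).symm ▸ hC (φ n))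
        simpa using this⟩
    obtain ⟨σ, hσ, hσk, hσl⟩ :=
      exists_randomIndex_tendsto (fun n => (measurable_pi_apply j).comp (hw n)) hwb
    have hσt : ∀ ω, Tendsto (fun k => σ k ω) atTop atTop := fun ω =>
      tendsto_atTop_mono (fun k => hσk k ω) tendsto_id
    refine ⟨fun k ω => w (σ k ω) ω, fun k => measurable_randomIndex hw (hσ k), fun ω => ?_,
      fun ω i hi => ?_⟩
    · obtain ⟨φ, hφt, hφ⟩ := hsub ω
      exact ⟨fun k => φ (σ k ω), hφt.comp (hσt ω), fun k => hφ _⟩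
    · rcases Finset.mem_insert.1 hi with rfl | hi
      · exact hσl ω
      · obtain ⟨l, hl⟩ := hlim ω i hi
        exact ⟨l, hl.comp (hσt ω)⟩

theorem exists_measurable_clusterPt_of_bounded {v : ℕ → Ω → (ι → ℝ)}
    (hv : ∀ n, Measurable (v n)) (hb : ∀ ω, ∃ C, ∀ n, ‖v n ω‖ ≤ C) :
    ∃ x : Ω → (ι → ℝ), Measurable x ∧ ∀ ω, ∃ φ : ℕ → ℕ, Tendsto φ atTop atTop ∧
      Tendsto (fun k => v (φ k) ω) atTop (𝓝 (x ω)) := by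
  obtain ⟨w, hw, hsub, hlim⟩ := exists_measurable_subseq_tendsto_of_bounded hv hb Finset.univ
  choose l hl using fun ω i => hlim ω i (Finset.mem_univ i)
  have hl' : ∀ ω, Tendsto (fun k => w k ω) atTop (𝓝 (l ω)) := fun ω => tendsto_pi_nhds.2 (hl ω)
  refine ⟨l, measurable_of_tendsto_metrizable hw (tendsto_pi_nhds.2 hl'), fun ω => ?_⟩
  obtain ⟨φ, hφt, hφ⟩ := hsub ω
  exact ⟨φ, hφt, by simpa only [hφ] using hl' ω⟩

theorem measurable_norm_inv_smul {f : Ω → (ι → ℝ)} (hf : Measurable f) :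
    Measurable fun ω => ‖f ω‖⁻¹ • f ω :=
  hf.norm.inv.smul hf

theorem measurable_sub_div_smul {f g : Ω → (ι → ℝ)} (hf : Measurable f) (hg : Measurable g)
    (j : ι) : Measurable fun ω => f ω - (f ω j / g ω j) • g ω :=
  hf.sub ((((measurable_pi_apply j).comp hf).div ((measurable_pi_apply j).comp hg)).smul hg)

theorem measurableSet_tendsto_norm_atTop {v : ℕ → Ω → (ι → ℝ)} (hv : ∀ n, Measurable (v n)) :
    MeasurableSet {ω | Tendsto (fun n => ‖v n ω‖) atTop atTop} :=
  measurableSet_tendsto _ fun n => (hv n).norm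

/-- Measurable selection of a cluster point of a sequence of random vectors, wherever the
sequence does not escape to infinity. -/
theorem exists_measurable_clusterPt {v : ℕ → Ω → (ι → ℝ)} (hv : ∀ n, Measurable (v n)) :
    ∃ x : Ω → (ι → ℝ), Measurable x ∧ ∀ ω, ¬ Tendsto (fun n => ‖v n ω‖) atTop atTop →
      ∃ φ : ℕ → ℕ, Tendsto φ atTop atTop ∧ Tendsto (fun k => v (φ k) ω) atTop (𝓝 (x ω)) := by
  classical
  let B : ℕ → Set Ω := fun N => {ω | ∀ k, ∃ n, k ≤ n ∧ ‖v n ω‖ ≤ N}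
  have hB : ∀ N, MeasurableSet (B N) := fun N => by
    have : B N = ⋂ k, ⋃ n, {ω | k ≤ n ∧ ‖v n ω‖ ≤ N} := by
      ext ω; simp [B]
    rw [this]
    exact MeasurableSet.iInter fun k => MeasurableSet.iUnion fun n =>
      (MeasurableSet.const _).inter (measurableSet_le (hv n).norm measurable_const)
  -- The second alternative makes the search for an index total; outside `B N` its result is
  -- discarded by the indicator below.
  have hex : ∀ (N k : ℕ) (ω : Ω), ∃ n, k ≤ n ∧ (‖v n ω‖ ≤ N ∨ ω ∉ B N) := fun N k ω => by
    by_cases h : ω ∈ B N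
    · obtain ⟨n, h1, h2⟩ := h k
      exact ⟨n, h1, Or.inl h2⟩
    · exact ⟨k, le_rfl, Or.inr h⟩
  let τ : ℕ → ℕ → Ω → ℕ := fun N k ω => Nat.find (hex N k ω)
  have hτ : ∀ N k, Measurable (τ N k) := fun N k => measurable_find _ fun n =>
    (MeasurableSet.const _).inter
      ((measurableSet_le (hv n).norm measurable_const).union (hB N).compl)
  have hsel : ∀ N : ℕ, ∃ x : Ω → (ι → ℝ), Measurable x ∧ ∀ ω ∈ B N, ∃ φ : ℕ → ℕ,
      Tendsto φ atTop atTop ∧ Tendsto (fun k => v (φ k) ω) atTop (𝓝 (x ω)) := fun N => by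
    obtain ⟨x, hx, hxφ⟩ := exists_measurable_clusterPt_of_bounded
      (v := fun k => (B N).indicator fun ω => v (τ N k ω) ω)
      (fun k => (measurable_randomIndex hv (hτ N k)).indicator (hB N))
      (fun ω => ⟨N, fun k => by
        by_cases h : ω ∈ B N
        · rw [Set.indicator_of_mem h]
          exact (Nat.find_spec (hex N k ω)).2.resolve_right (not_not.2 h)
        · simp [Set.indicator_of_notMem h]⟩)
    refine ⟨x, hx, fun ω hω => ?_⟩
    obtain ⟨φ, hφt, hφ⟩ := hxφ ω
    refine ⟨fun k => τ N (φ k) ω, ?_, by simpa only [Set.indicator_of_mem hω] using hφ⟩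
    exact tendsto_atTop_mono (fun k => (Nat.find_spec (hex N (φ k) ω)).1) hφt
  choose x hx hxφ using hsel
  have hexN : ∀ ω, ∃ N, ω ∈ B N ∨ ω ∈ (⋃ N, B N)ᶜ := fun ω => by
    by_cases h : ω ∈ ⋃ N, B N
    · obtain ⟨N, hN⟩ := Set.mem_iUnion.1 h
      exact ⟨N, Or.inl hN⟩
    · exact ⟨0, Or.inr h⟩
  refine ⟨fun ω => x (Nat.find (hexN ω)) ω, measurable_randomIndex hx
    (measurable_find _ fun N => (hB N).union (MeasurableSet.iUnion hB).compl), fun ω hω => ?_⟩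
  refine hxφ _ ω ((Nat.find_spec (hexN ω)).resolve_right fun h => hω ?_)
  refine tendsto_atTop.2 fun b => ?_
  obtain ⟨N, hN⟩ := exists_nat_ge b
  have hωN : ω ∉ B N := fun h' => h (Set.mem_iUnion.2 ⟨N, h'⟩)
  simp only [B, Set.mem_ofPred_eq, not_forall, not_exists, not_and, not_le] at hωN
  obtain ⟨k, hk⟩ := hωN
  exact eventually_atTop.2 ⟨k, fun n hn => hN.trans (hk n hn).le⟩

end Selection

/-! ### Cluster points of one-period gains -/

section OneStep

variable {Ω : Type*} {ι : Type*} [Fintype ι]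

/-- Absence of arbitrage in a single trading period with price increment `Δ`, for strategies that
are measurable with respect to `G`. -/
def OneStepNA {m : MeasurableSpace Ω} (P : Measure Ω) (G : MeasurableSpace Ω)
    (Δ : Ω → (ι → ℝ)) : Prop :=
  ∀ ζ : Ω → (ι → ℝ), Measurable[G] ζ → (∀ᵐ ω ∂P, 0 ≤ ζ ω ⬝ᵥ Δ ω) → ∀ᵐ ω ∂P, ζ ω ⬝ᵥ Δ ω = 0

variable {G m : MeasurableSpace Ω} {P : Measure Ω} {Δ : Ω → (ι → ℝ)}

/-- Where the strategies do not escape to infinity, a cluster point of them suffices. Where they do,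
the limiting direction has zero gain by absence of arbitrage, so multiples of it can be subtracted
to eliminate one asset without changing any gain. This is an induction on the set `s` of assets in
use; the event `B` localises it, as the eliminated asset depends on `ω`. -/
theorem OneStepNA.exists_clusterPt_on (hNA : OneStepNA P G Δ) (s : Finset ι) :
    ∀ (B : Set Ω) (ξ : ℕ → Ω → (ι → ℝ)), MeasurableSet[G] B → (∀ n, Measurable[G] (ξ n)) →
      (∀ ω ∈ B, ∀ n, ∀ i ∉ s, ξ n ω i = 0) →
      (∀ᵐ ω ∂P, ω ∈ B → ∃ C, ∀ n, C ≤ ξ n ω ⬝ᵥ Δ ω) →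
      ∃ x : Ω → (ι → ℝ), Measurable[G] x ∧ ∀ᵐ ω ∂P, ω ∈ B → ∃ φ : ℕ → ℕ,
        Tendsto φ atTop atTop ∧
        Tendsto (fun k => ξ (φ k) ω ⬝ᵥ Δ ω) atTop (𝓝 (x ω ⬝ᵥ Δ ω)) := by
  classical
  induction s using Finset.strongInduction with
  | H s ih =>
  intro B ξ hB hξ hsupp hbdd
  have hdot : ∀ ω, Continuous fun y : ι → ℝ => y ⬝ᵥ Δ ω := fun ω => by
    unfold dotProduct; fun_prop
  obtain ⟨x₀, hx₀, hx₀φ⟩ := exists_measurable_clusterPt hξ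
  let A : Set Ω := {ω | Tendsto (fun n => ‖ξ n ω‖) atTop atTop} ∩ B
  have hA : MeasurableSet[G] A := by
    exact MeasurableSet.inter (measurableSet_tendsto_norm_atTop hξ) hB
  let u : ℕ → Ω → (ι → ℝ) := fun n => A.indicator fun ω => ‖ξ n ω‖⁻¹ • ξ n ω
  have hu : ∀ n, Measurable[G] (u n) := fun n =>
    Measurable.indicator (measurable_norm_inv_smul (hξ n)) hA
  obtain ⟨η, hη, hηφ⟩ := exists_measurable_clusterPt_of_bounded hu fun ω => ⟨1, fun n => by
    by_cases h : ω ∈ A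
    · simp only [u, Set.indicator_of_mem h, norm_smul, norm_inv, norm_norm]
      exact inv_mul_le_one
    · simp [u, Set.indicator_of_notMem h]⟩
  -- After normalisation the lower bound `C` is divided by norms tending to infinity, so the
  -- limiting gain is nonnegative.
  have hη0 : ∀ᵐ ω ∂P, η ω ⬝ᵥ Δ ω = 0 := by
    refine hNA η hη ?_
    filter_upwards [hbdd] with ω hω
    obtain ⟨φ, hφt, hφ⟩ := hηφ ω
    have h1 := ((hdot ω).tendsto _).comp hφ
    by_cases h : ω ∈ A
    · obtain ⟨C, hC⟩ := hω h.2
      have h2 : Tendsto (fun k => ‖ξ (φ k) ω‖⁻¹ * C) atTop (𝓝 0) := by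
        simpa using ((tendsto_inv_atTop_zero.comp (h.1.comp hφt)).mul_const C)
      refine le_of_tendsto_of_tendsto' h2 h1 fun k => ?_
      simp only [u, Set.indicator_of_mem h, Function.comp, smul_dotProduct, smul_eq_mul]
      exact mul_le_mul_of_nonneg_left (hC _) (by positivity)
    · refine ge_of_tendsto' h1 fun k => ?_
      simp [u, Set.indicator_of_notMem h]
  have hη1 : ∀ ω ∈ A, ‖η ω‖ = 1 ∧ ∀ i ∉ s, η ω i = 0 := fun ω h => by
    obtain ⟨φ, hφt, hφ⟩ := hηφ ω
    constructor
    · refine tendsto_nhds_unique hφ.norm (tendsto_const_nhds.congr' ?_)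
      filter_upwards [(h.1.comp hφt).eventually_gt_atTop 0] with k hk
      simp only [u, Set.indicator_of_mem h, norm_smul, norm_inv, norm_norm]
      exact (inv_mul_cancel₀ hk.ne').symm
    · intro i hi
      refine tendsto_nhds_unique ((tendsto_pi_nhds.1 hφ) i) (tendsto_const_nhds.congr fun k => ?_)
      simp [u, Set.indicator_of_mem h, hsupp ω h.2 _ i hi]
  have hstep : ∀ j ∈ s, ∃ x : Ω → (ι → ℝ), Measurable[G] x ∧
      ∀ᵐ ω ∂P, ω ∈ A ∩ {ω | η ω j ≠ 0} → ∃ φ : ℕ → ℕ, Tendsto φ atTop atTop ∧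
        Tendsto (fun k => ξ (φ k) ω ⬝ᵥ Δ ω) atTop (𝓝 (x ω ⬝ᵥ Δ ω)) := by
    intro j hj
    have hηj : Measurable[G] fun ω => η ω j := (measurable_pi_apply j).comp hη
    have hdot' : ∀ᵐ ω ∂P, ∀ n,
        (ξ n ω - (ξ n ω j / η ω j) • η ω) ⬝ᵥ Δ ω = ξ n ω ⬝ᵥ Δ ω := by
      filter_upwards [hη0] with ω hω n
      rw [sub_dotProduct, smul_dotProduct, hω, smul_zero, sub_zero]
    obtain ⟨x, hx, hxφ⟩ := ih (s.erase j) (Finset.erase_ssubset hj) (A ∩ {ω | η ω j ≠ 0})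
      (fun n ω => ξ n ω - (ξ n ω j / η ω j) • η ω)
      (hA.inter (hηj (measurableSet_singleton 0).compl))
      (fun n => measurable_sub_div_smul (hξ n) hη j)
      (by
        rintro ω ⟨hωA, hωj⟩ n i hi
        simp only [Pi.sub_apply, Pi.smul_apply, smul_eq_mul]
        rcases eq_or_ne i j with rfl | hij
        · rw [div_mul_cancel₀ _ hωj, sub_self]
        · have his : i ∉ s := fun h => hi (Finset.mem_erase.2 ⟨hij, h⟩)
          rw [hsupp ω hωA.2 n i his, (hη1 ω hωA).2 i his, mul_zero, sub_zero])
      (by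
        filter_upwards [hbdd, hdot'] with ω h1 h2 h3
        obtain ⟨C, hC⟩ := h1 h3.1.2
        exact ⟨C, fun n => (h2 n).symm ▸ hC n⟩)
    refine ⟨x, hx, ?_⟩
    filter_upwards [hxφ, hdot'] with ω h1 h2 h3
    obtain ⟨φ, hφt, hφ⟩ := h1 h3
    exact ⟨φ, hφt, by simpa only [h2] using hφ⟩
  -- The strategies for the events `η ω j ≠ 0` are glued; these events cover `A`, since there `η`
  -- has norm one and is supported in `s`.
  have hcover : ∀ r : Finset ι, r ⊆ s → ∃ x : Ω → (ι → ℝ), Measurable[G] x ∧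
      ∀ᵐ ω ∂P, (ω ∈ A ∧ ∃ j ∈ r, η ω j ≠ 0) → ∃ φ : ℕ → ℕ, Tendsto φ atTop atTop ∧
        Tendsto (fun k => ξ (φ k) ω ⬝ᵥ Δ ω) atTop (𝓝 (x ω ⬝ᵥ Δ ω)) := by
    intro r
    induction r using Finset.induction_on with
    | empty => exact fun _ => ⟨fun _ => 0, measurable_const, by simp⟩
    | insert j r _ ihr =>
      intro hr
      obtain ⟨x, hx, hxφ⟩ := ihr ((Finset.subset_insert _ _).trans hr)
      obtain ⟨y, hy, hyφ⟩ := hstep j (hr (Finset.mem_insert_self _ _))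
      have hηj : MeasurableSet[G] {ω | η ω j ≠ 0} :=
        ((measurable_pi_apply j).comp hη) (measurableSet_singleton 0).compl
      refine ⟨{ω | η ω j ≠ 0}.piecewise y x, Measurable.piecewise hηj hy hx, ?_⟩
      filter_upwards [hxφ, hyφ] with ω h1 h2
      rintro ⟨hωA, i, hi, hi0⟩
      by_cases h : η ω j ≠ 0
      · rw [Set.piecewise_eq_of_mem _ _ _ (show ω ∈ {ω | η ω j ≠ 0} from h)]
        exact h2 ⟨hωA, h⟩
      · rw [Set.piecewise_eq_of_notMem _ _ _ (show ω ∉ {ω | η ω j ≠ 0} from h)]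
        rcases Finset.mem_insert.1 hi with rfl | hi
        · exact absurd hi0 h
        · exact h1 ⟨hωA, i, hi, hi0⟩
  obtain ⟨x, hx, hxφ⟩ := hcover s subset_rfl
  refine ⟨A.piecewise x x₀, Measurable.piecewise hA hx hx₀, ?_⟩
  filter_upwards [hxφ] with ω h1 hωB
  by_cases h : ω ∈ A
  · rw [Set.piecewise_eq_of_mem _ _ _ h]
    refine h1 ⟨h, ?_⟩
    by_contra! hcon
    have hz : η ω = 0 := funext fun i =>
      if hi : i ∈ s then hcon i hi else (hη1 ω h).2 i hi
    have := (hη1 ω h).1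
    rw [hz, norm_zero] at this
    exact zero_ne_one this
  · rw [Set.piecewise_eq_of_notMem _ _ _ h]
    obtain ⟨φ, hφt, hφ⟩ := hx₀φ ω fun h' => h ⟨h', hωB⟩
    exact ⟨φ, hφt, ((hdot ω).tendsto _).comp hφ⟩

/-- Under absence of arbitrage, a sequence of one-period gains that is bounded from below almost
surely has a one-period gain among its pointwise cluster points. -/
theorem OneStepNA.exists_clusterPt (hNA : OneStepNA P G Δ) {ξ : ℕ → Ω → (ι → ℝ)}
    (hξ : ∀ n, Measurable[G] (ξ n)) (hbdd : ∀ᵐ ω ∂P, ∃ C, ∀ n, C ≤ ξ n ω ⬝ᵥ Δ ω) :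
    ∃ x : Ω → (ι → ℝ), Measurable[G] x ∧ ∀ᵐ ω ∂P, ∃ φ : ℕ → ℕ, Tendsto φ atTop atTop ∧
      Tendsto (fun k => ξ (φ k) ω ⬝ᵥ Δ ω) atTop (𝓝 (x ω ⬝ᵥ Δ ω)) := by
  obtain ⟨x, hx, hxφ⟩ := hNA.exists_clusterPt_on Finset.univ Set.univ ξ MeasurableSet.univ hξ
    (by simp) (by simpa using hbdd)
  exact ⟨x, hx, by simpa using hxφ⟩

end OneStep

/-! ### Exponential minimisation and the Esscher density -/

section Esscher

variable {Ω : Type*} {ι : Type*} [Fintype ι]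

theorem abs_dotProduct_le (x y : ι → ℝ) : |x ⬝ᵥ y| ≤ Fintype.card ι * (‖x‖ * ‖y‖) := by
  unfold dotProduct
  refine (Finset.abs_sum_le_sum_abs _ _).trans ?_
  have : ∀ i ∈ Finset.univ, |x i * y i| ≤ ‖x‖ * ‖y‖ := fun i _ => by
    rw [abs_mul]
    exact mul_le_mul (norm_le_pi_norm x i) (norm_le_pi_norm y i) (abs_nonneg _) (norm_nonneg _)
  simpa using Finset.sum_le_sum this

theorem exists_abs_dotProduct_le {f g : Ω → (ι → ℝ)} (hf : ∃ C, ∀ ω, ‖f ω‖ ≤ C)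
    (hg : ∃ C, ∀ ω, ‖g ω‖ ≤ C) : ∃ C, 0 < C ∧ ∀ ω, |f ω ⬝ᵥ g ω| ≤ C := by
  obtain ⟨C, hC⟩ := hf
  obtain ⟨D, hD⟩ := hg
  refine ⟨Fintype.card ι * (|C| * |D|) + 1, by positivity, fun ω => ?_⟩
  have h1 : ‖f ω‖ * ‖g ω‖ ≤ |C| * |D| :=
    mul_le_mul ((hC ω).trans (le_abs_self C)) ((hD ω).trans (le_abs_self D)) (norm_nonneg _)
      (abs_nonneg _)
  have h2 := mul_le_mul_of_nonneg_left h1 (Nat.cast_nonneg (α := ℝ) (Fintype.card ι))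
  linarith [abs_dotProduct_le (f ω) (g ω)]

theorem measurable_dotProduct {mΩ : MeasurableSpace Ω} {f g : Ω → (ι → ℝ)} (hf : Measurable f)
    (hg : Measurable g) : Measurable fun ω => f ω ⬝ᵥ g ω := by
  unfold dotProduct
  exact Finset.measurable_sum _ fun i _ =>
    ((measurable_pi_apply i).comp hf).mul ((measurable_pi_apply i).comp hg)

variable {G m : MeasurableSpace Ω} {μ : Measure Ω} {Δ : Ω → (ι → ℝ)}

theorem inner_toLp_toLp {f g : Ω → ℝ} (hf : MemLp f 2 μ) (hg : MemLp g 2 μ) :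
    inner ℝ (hf.toLp f) (hg.toLp g) = ∫ ω, f ω * g ω ∂μ := by
  rw [L2.inner_def]
  refine integral_congr_ae ?_
  filter_upwards [hf.coeFn_toLp, hg.coeFn_toLp] with ω h1 h2
  rw [h1, h2]
  simp [mul_comm]

theorem integrable_exp_add_of_bounded {f g : Ω → ℝ} (hf : Integrable (fun ω => Real.exp (f ω)) μ)
    (hg : Measurable g) (hb : ∃ C, ∀ ω, |g ω| ≤ C) :
    Integrable (fun ω => Real.exp (f ω + g ω)) μ := by
  obtain ⟨C, hC⟩ := hb
  simp only [Real.exp_add]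
  refine hf.mul_bdd (c := Real.exp C) hg.exp.aestronglyMeasurable (ae_of_all _ fun ω => ?_)
  rw [Real.norm_eq_abs, Real.abs_exp]
  exact Real.exp_le_exp.2 ((le_abs_self _).trans (hC ω))

/-- The convex functional `ξ ↦ 𝔼[exp (-ξ · Δ)]` attains its minimum over one-period strategies. -/
theorem OneStepNA.exists_isMinOn_exp [IsFiniteMeasure μ] (hG : G ≤ m) (hΔ : Measurable Δ)
    (hNA : OneStepNA μ G Δ) :
    ∃ x : Ω → (ι → ℝ), Measurable[G] x ∧ Integrable (fun ω => Real.exp (-(x ω ⬝ᵥ Δ ω))) μ ∧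
      ∀ y : Ω → (ι → ℝ), Measurable[G] y → Integrable (fun ω => Real.exp (-(y ω ⬝ᵥ Δ ω))) μ →
        ∫ ω, Real.exp (-(x ω ⬝ᵥ Δ ω)) ∂μ ≤ ∫ ω, Real.exp (-(y ω ⬝ᵥ Δ ω)) ∂μ := by
  let S : Set (Ω → (ι → ℝ)) :=
    {y | Measurable[G] y ∧ Integrable (fun ω => Real.exp (-(y ω ⬝ᵥ Δ ω))) μ}
  let I : (Ω → (ι → ℝ)) → ℝ := fun y => ∫ ω, Real.exp (-(y ω ⬝ᵥ Δ ω)) ∂μ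
  have hS : (I '' S).Nonempty := ⟨_, fun _ => 0, ⟨measurable_const, by simp⟩, rfl⟩
  have hbelow : BddBelow (I '' S) := ⟨0, by
    rintro _ ⟨y, -, rfl⟩
    exact integral_nonneg fun ω => (Real.exp_pos _).le⟩
  obtain ⟨u, -, hulim, huS⟩ := exists_seq_tendsto_sInf hS hbelow
  set i := sInf (I '' S)
  choose ξ hξS hξI using huS
  have hmin : ∀ y ∈ S, i ≤ I y := fun y hy => csInf_le hbelow (Set.mem_image_of_mem I hy)
  -- With half the exponent, `h n` lies in `L²` and `h n * h k` is the integrand of the midpoint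
  -- strategy. Inner products are therefore at least the infimum, which makes a minimising sequence
  -- Cauchy.
  let h : ℕ → Ω → ℝ := fun n ω => Real.exp (-(ξ n ω ⬝ᵥ Δ ω) / 2)
  have hhm : ∀ n, Measurable (h n) := fun n =>
    ((measurable_dotProduct ((hξS n).1.mono hG le_rfl) hΔ).neg.div_const 2).exp
  have hsq : ∀ n ω, h n ω * h n ω = Real.exp (-(ξ n ω ⬝ᵥ Δ ω)) := fun n ω => by
    simp only [h]
    rw [← Real.exp_add]
    congr 1
    ring
  have hh : ∀ n, MemLp (h n) 2 μ := fun n => by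
    rw [memLp_two_iff_integrable_sq (hhm n).aestronglyMeasurable]
    simpa only [pow_two, hsq] using (hξS n).2
  let F : ℕ → Lp ℝ 2 μ := fun n => (hh n).toLp (h n)
  have hFsq : ∀ n, ‖F n‖ ^ 2 = u n := fun n => by
    rw [← real_inner_self_eq_norm_sq, inner_toLp_toLp]
    simp only [hsq]
    exact hξI n
  have hFinner : ∀ n k, i ≤ inner ℝ (F n) (F k) := fun n k => by
    rw [inner_toLp_toLp]
    have hprod : ∀ ω, h n ω * h k ω =
        Real.exp (-(((1 / 2 : ℝ) • (ξ n ω + ξ k ω)) ⬝ᵥ Δ ω)) := fun ω => by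
      simp only [h]
      rw [← Real.exp_add, smul_dotProduct, add_dotProduct, smul_eq_mul]
      congr 1
      ring
    simp only [hprod]
    refine hmin _ ⟨((hξS n).1.add (hξS k).1).const_smul (1 / 2 : ℝ), ?_⟩
    have := (hh n).integrable_mul (hh k)
    exact this.congr (ae_of_all _ hprod)
  have hFdist : ∀ n k, ‖F n - F k‖ ^ 2 ≤ (u n - i) + (u k - i) := fun n k => by
    rw [norm_sub_sq_real, hFsq, hFsq]
    linarith [hFinner n k]
  have hcauchy : CauchySeq F := by
    refine Metric.cauchySeq_iff.2 fun ε hε => ?_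
    have hev : ∀ᶠ n in atTop, u n < i + ε ^ 2 / 2 :=
      (tendsto_order.1 hulim).2 _ (by have : 0 < ε ^ 2 := by positivity
                                      linarith)
    obtain ⟨N, hN⟩ := eventually_atTop.1 hev
    refine ⟨N, fun n hn k hk => ?_⟩
    rw [dist_eq_norm]
    refine lt_of_pow_lt_pow_left₀ 2 hε.le ?_
    linarith [hFdist n k, hN n hn, hN k hk]
  obtain ⟨f, hf⟩ := cauchySeq_tendsto_of_complete hcauchy
  obtain ⟨ns, hns, hae⟩ := (tendstoInMeasure_of_tendsto_Lp hf).exists_seq_tendsto_ae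
  have hae' : ∀ᵐ ω ∂μ, Tendsto (fun k => h (ns k) ω) atTop (𝓝 (f ω)) := by
    filter_upwards [hae, ae_all_iff.2 fun k => (hh (ns k)).coeFn_toLp] with ω h1 h2
    exact h1.congr h2
  -- Convergence of `h (ns k)` bounds it above, hence bounds the gains below. The resulting gain is
  -- finite, so the limit `f` cannot vanish on a set of positive measure.
  obtain ⟨x, hx, hxφ⟩ := hNA.exists_clusterPt (ξ := fun k => ξ (ns k)) (fun k => (hξS _).1) (by
    filter_upwards [hae'] with ω hω
    obtain ⟨C, hC⟩ := hω.bddAbove_range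
    refine ⟨-2 * Real.log C, fun k => ?_⟩
    have h1 : h (ns k) ω ≤ C := hC ⟨k, rfl⟩
    have h2 := Real.log_le_log (Real.exp_pos _) h1
    rw [Real.log_exp] at h2
    linarith)
  have hxf : ∀ᵐ ω ∂μ, f ω * f ω = Real.exp (-(x ω ⬝ᵥ Δ ω)) := by
    filter_upwards [hae', hxφ] with ω h1 h2
    obtain ⟨φ, hφt, hφ⟩ := h2
    refine tendsto_nhds_unique ((h1.comp hφt).mul (h1.comp hφt)) ?_
    simp only [Function.comp, hsq]
    exact (Real.continuous_exp.tendsto _).comp hφ.neg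
  have hxint : Integrable (fun ω => Real.exp (-(x ω ⬝ᵥ Δ ω))) μ :=
    ((Lp.memLp f).integrable_mul (Lp.memLp f)).congr hxf
  have hIx : I x = i := by
    have h1 : ‖f‖ ^ 2 = I x := by
      rw [← real_inner_self_eq_norm_sq, L2.inner_def]
      refine integral_congr_ae ?_
      filter_upwards [hxf] with ω hω
      rw [← hω]
      simp [pow_two]
    rw [← h1]
    refine tendsto_nhds_unique (hf.norm.pow 2) ?_
    simpa only [hFsq] using hulim
  exact ⟨x, hx, hxint, fun y hy hyint => hIx.le.trans (hmin y ⟨hy, hyint⟩)⟩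

/-- Existence of the one-period Esscher martingale density. -/
theorem OneStepNA.exists_esscher [IsFiniteMeasure μ] (hG : G ≤ m) (hΔ : Measurable Δ)
    (hb : ∃ C, ∀ ω, ‖Δ ω‖ ≤ C) (hNA : OneStepNA μ G Δ) :
    ∃ x : Ω → (ι → ℝ), Measurable[G] x ∧ Integrable (fun ω => Real.exp (-(x ω ⬝ᵥ Δ ω))) μ ∧
      ∀ ζ : Ω → (ι → ℝ), Measurable[G] ζ → (∃ C, ∀ ω, ‖ζ ω‖ ≤ C) →
        ∫ ω, Real.exp (-(x ω ⬝ᵥ Δ ω)) * (ζ ω ⬝ᵥ Δ ω) ∂μ = 0 := by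
  obtain ⟨x, hx, hxint, hxmin⟩ := hNA.exists_isMinOn_exp hG hΔ
  refine ⟨x, hx, hxint, ?_⟩
  have key : ∀ ζ : Ω → (ι → ℝ), Measurable[G] ζ → (∃ C, ∀ ω, ‖ζ ω‖ ≤ C) →
      ∫ ω, Real.exp (-(x ω ⬝ᵥ Δ ω)) * (ζ ω ⬝ᵥ Δ ω) ∂μ ≤ 0 := by
    intro ζ hζ hζb
    obtain ⟨C, hC0, hC⟩ := exists_abs_dotProduct_le hζb hb
    have hζm : Measurable fun ω => ζ ω ⬝ᵥ Δ ω := measurable_dotProduct (hζ.mono hG le_rfl) hΔ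
    set D : Ω → ℝ := fun ω => Real.exp (-(x ω ⬝ᵥ Δ ω))
    have hDζ : Integrable (fun ω => D ω * (ζ ω ⬝ᵥ Δ ω)) μ :=
      hxint.mul_bdd (c := C) hζm.aestronglyMeasurable (ae_of_all _ hC)
    set J := ∫ ω, D ω * (ζ ω ⬝ᵥ Δ ω) ∂μ
    -- First-order condition at the minimiser in direction `ζ`; `ε * C ≤ 1` is the range in which
    -- `exp v ≤ 1 + v + v ^ 2` is used. Applying it to `-ζ` gives the reverse inequality.
    have hstep : ∀ ε : ℝ, 0 < ε → ε * C ≤ 1 → J ≤ ε * (C ^ 2 * ∫ ω, D ω ∂μ) := by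
      intro ε hε hεC
      have hexp : ∀ ω, -((x ω + ε • ζ ω) ⬝ᵥ Δ ω) = -(x ω ⬝ᵥ Δ ω) + -(ε * (ζ ω ⬝ᵥ Δ ω)) :=
        fun ω => by rw [add_dotProduct, smul_dotProduct, smul_eq_mul]; ring
      have hint : Integrable (fun ω => Real.exp (-((x ω + ε • ζ ω) ⬝ᵥ Δ ω))) μ := by
        simp only [hexp]
        refine integrable_exp_add_of_bounded hxint (hζm.const_mul ε).neg ⟨ε * C, fun ω => ?_⟩
        rw [abs_neg, abs_mul, abs_of_pos hε]
        exact mul_le_mul_of_nonneg_left (hC ω) hε.le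
      have h1 := hxmin _ (hx.add (hζ.const_smul ε)) hint
      have h2 : ∫ ω, Real.exp (-((x ω + ε • ζ ω) ⬝ᵥ Δ ω)) ∂μ ≤
          ∫ ω, (D ω - ε * (D ω * (ζ ω ⬝ᵥ Δ ω)) + ε ^ 2 * C ^ 2 * D ω) ∂μ := by
        refine integral_mono hint
          ((hxint.sub (hDζ.const_mul ε)).add (hxint.const_mul _)) fun ω => ?_
        simp only [hexp, Real.exp_add]
        have h3 : |(-(ε * (ζ ω ⬝ᵥ Δ ω)))| ≤ ε * C := by
          rw [abs_neg, abs_mul, abs_of_pos hε]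
          exact mul_le_mul_of_nonneg_left (hC ω) hε.le
        have h4 := (abs_le.1 (Real.abs_exp_sub_one_sub_id_le (h3.trans hεC))).2
        have h5 : (-(ε * (ζ ω ⬝ᵥ Δ ω))) ^ 2 ≤ ε ^ 2 * C ^ 2 := by
          rw [← mul_pow]
          exact sq_le_sq' (abs_le.1 h3).1 (abs_le.1 h3).2
        have h6 : Real.exp (-(ε * (ζ ω ⬝ᵥ Δ ω))) ≤
            1 - ε * (ζ ω ⬝ᵥ Δ ω) + ε ^ 2 * C ^ 2 := by linarith
        have h7 := mul_le_mul_of_nonneg_left h6 (Real.exp_pos (-(x ω ⬝ᵥ Δ ω))).le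
        simp only [D]
        linarith
      have h3 : ∫ ω, (D ω - ε * (D ω * (ζ ω ⬝ᵥ Δ ω)) + ε ^ 2 * C ^ 2 * D ω) ∂μ =
          ∫ ω, D ω ∂μ - ε * J + ε ^ 2 * C ^ 2 * ∫ ω, D ω ∂μ := by
        have hs : Integrable (fun ω => D ω - ε * (D ω * (ζ ω ⬝ᵥ Δ ω))) μ :=
          hxint.sub (hDζ.const_mul ε)
        rw [integral_add hs (hxint.const_mul _),
          integral_sub hxint (hDζ.const_mul ε), integral_const_mul, integral_const_mul]
      have h4 : ε * J ≤ ε * (ε * (C ^ 2 * ∫ ω, D ω ∂μ)) := by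
        rw [h3] at h2
        have := h1.trans h2
        linarith
      exact le_of_mul_le_mul_left h4 hε
    have hlim : Tendsto (fun ε : ℝ => ε * (C ^ 2 * ∫ ω, D ω ∂μ)) (𝓝[>] 0) (𝓝 0) := by
      have : Tendsto (fun ε : ℝ => ε * (C ^ 2 * ∫ ω, D ω ∂μ)) (𝓝 0)
          (𝓝 (0 * (C ^ 2 * ∫ ω, D ω ∂μ))) := tendsto_id.mul_const _
      rw [zero_mul] at this
      exact this.mono_left nhdsWithin_le_nhds
    refine ge_of_tendsto hlim ?_
    filter_upwards [Ioc_mem_nhdsGT (show (0 : ℝ) < 1 / C by positivity)] with ε hε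
    exact hstep ε hε.1 ((le_div_iff₀ hC0).1 hε.2)
  intro ζ hζ hζb
  refine le_antisymm (key ζ hζ hζb) ?_
  have h1 := key (fun ω => -ζ ω) hζ.neg (by simpa using hζb)
  simp only [neg_dotProduct, mul_neg, integral_neg] at h1
  linarith

end Esscher

/-! ### Equivalent martingale measures for one period -/

section MartingaleMeasures

variable {Ω : Type*} {ι : Type*} [Fintype ι] {G m : MeasurableSpace Ω} {P Q : Measure Ω}
  {Δ : Ω → (ι → ℝ)}

/-- The measure is left unnormalised: only its null sets and the vanishing or sign of integrals
matter later. -/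
theorem exists_measure_with_density {D : Ω → ℝ} (hD : Measurable D) (hD0 : ∀ ω, 0 < D ω)
    (hDi : Integrable D P) :
    ∃ Q : Measure Ω, IsFiniteMeasure Q ∧ P ≪ Q ∧ Q ≪ P ∧
      (∀ f : Ω → ℝ, Integrable f Q ↔ Integrable (fun ω => D ω * f ω) P) ∧
      ∀ f : Ω → ℝ, ∫ ω, f ω ∂Q = ∫ ω, D ω * f ω ∂P := by
  have hm : Measurable fun ω => ENNReal.ofReal (D ω) := hD.ennreal_ofReal
  have htop : ∀ᵐ ω ∂P, ENNReal.ofReal (D ω) < ⊤ := ae_of_all _ fun _ => ENNReal.ofReal_lt_top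
  refine ⟨P.withDensity fun ω => ENNReal.ofReal (D ω),
    isFiniteMeasure_withDensity_ofReal hDi.2,
    withDensity_absolutelyContinuous' hm.aemeasurable
      (ae_of_all _ fun ω => (ENNReal.ofReal_pos.2 (hD0 ω)).ne'),
    withDensity_absolutelyContinuous _ _, fun f => ?_, fun f => ?_⟩
  · rw [integrable_withDensity_iff_integrable_smul' hm htop]
    simp only [ENNReal.toReal_ofReal (hD0 _).le, smul_eq_mul]
  · rw [integral_withDensity_eq_integral_toReal_smul hm htop]
    simp only [ENNReal.toReal_ofReal (hD0 _).le, smul_eq_mul]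

theorem OneStepNA.of_ac (h : OneStepNA P G Δ) (hPQ : P ≪ Q) (hQP : Q ≪ P) : OneStepNA Q G Δ :=
  fun ζ hζ h0 => hQP.ae_le (h ζ hζ (hPQ.ae_le h0))

/-- A positive factor does not change the sign of a gain, even if it is not known at the start of
the period. This permits scaling increments to be bounded. -/
theorem OneStepNA.inv_smul {S : Ω → ℝ} (hS : ∀ ω, 0 < S ω) (h : OneStepNA P G Δ) :
    OneStepNA P G fun ω => (S ω)⁻¹ • Δ ω := by
  intro ζ hζ h0
  simp only [dotProduct_smul, smul_eq_mul] at h0 ⊢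
  have := h ζ hζ (by
    filter_upwards [h0] with ω hω
    exact nonneg_of_mul_nonneg_right hω (inv_pos.2 (hS ω)))
  filter_upwards [this] with ω hω
  rw [hω, mul_zero]

/-- `Δ` is the increment of a martingale under `Q`, over a period starting with information `G`. -/
structure IsMartingaleIncrement {m : MeasurableSpace Ω} (Q : Measure Ω) (G : MeasurableSpace Ω)
    (Δ : Ω → (ι → ℝ)) : Prop where
  integrable : ∀ i, Integrable (fun ω => Δ ω i) Q
  integral_eq_zero : ∀ ζ : Ω → (ι → ℝ), Measurable[G] ζ → (∃ C, ∀ ω, ‖ζ ω‖ ≤ C) →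
    ∫ ω, ζ ω ⬝ᵥ Δ ω ∂Q = 0

theorem IsMartingaleIncrement.integrable_dotProduct (h : IsMartingaleIncrement Q G Δ) (hG : G ≤ m)
    {ζ : Ω → (ι → ℝ)} (hζ : Measurable[G] ζ) (hb : ∃ C, ∀ ω, ‖ζ ω‖ ≤ C) :
    Integrable (fun ω => ζ ω ⬝ᵥ Δ ω) Q := by
  obtain ⟨C, hC⟩ := hb
  unfold dotProduct
  refine integrable_finsetSum _ fun i _ => ?_
  refine (h.integrable i).bdd_mul (c := C)
    ((measurable_pi_apply i).comp (hζ.mono hG le_rfl)).aestronglyMeasurable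
    (ae_of_all _ fun ω => (norm_le_pi_norm (ζ ω) i).trans (hC ω))

theorem measurableSet_norm_le {mΩ : MeasurableSpace Ω} {f : Ω → (ι → ℝ)} (hf : Measurable f)
    (C : ℝ) : MeasurableSet {ω | ‖f ω‖ ≤ C} :=
  measurableSet_le hf.norm measurable_const

theorem norm_indicator_norm_le (f : Ω → (ι → ℝ)) (n : ℕ) (ω : Ω) :
    ‖{ω | ‖f ω‖ ≤ n}.indicator f ω‖ ≤ n := by
  by_cases h : ω ∈ {ω | ‖f ω‖ ≤ n}
  · rw [Set.indicator_of_mem h]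
    exact h
  · simp [Set.indicator_of_notMem h]

/-- A nonnegative gain with zero expectation vanishes. Strategies are truncated at norm `n`, because
the martingale property tests only bounded ones. -/
theorem IsMartingaleIncrement.oneStepNA (h : IsMartingaleIncrement Q G Δ) (hG : G ≤ m)
    (hPQ : P ≪ Q) (hQP : Q ≪ P) : OneStepNA P G Δ := by
  refine OneStepNA.of_ac (P := Q) (fun ζ hζ h0 => ?_) hQP hPQ
  have key : ∀ n : ℕ, ∀ᵐ ω ∂Q, {ω | ‖ζ ω‖ ≤ n}.indicator ζ ω ⬝ᵥ Δ ω = 0 := fun n => by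
    have hm : Measurable[G] ({ω | ‖ζ ω‖ ≤ n}.indicator ζ) :=
      hζ.indicator (measurableSet_norm_le hζ n)
    have hb : ∃ C, ∀ ω, ‖{ω | ‖ζ ω‖ ≤ n}.indicator ζ ω‖ ≤ C := ⟨n, norm_indicator_norm_le ζ n⟩
    refine (integral_eq_zero_iff_of_nonneg_ae ?_ (h.integrable_dotProduct hG hm hb)).1
      (h.integral_eq_zero _ hm hb)
    filter_upwards [h0] with ω hω
    by_cases h : ω ∈ {ω | ‖ζ ω‖ ≤ n}
    · simpa [Set.indicator_of_mem h] using hω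
    · simp [Set.indicator_of_notMem h]
  filter_upwards [ae_all_iff.2 key] with ω hω
  obtain ⟨n, hn⟩ := exists_nat_ge ‖ζ ω‖
  simpa [Set.indicator_of_mem (show ω ∈ {ω | ‖ζ ω‖ ≤ n} from hn)] using hω n

/-- The Esscher transform turns a bounded increment without arbitrage into a martingale
increment. -/
theorem OneStepNA.exists_esscher_measure [IsFiniteMeasure P] (hG : G ≤ m) (hΔ : Measurable Δ)
    (hb : ∃ C, ∀ ω, ‖Δ ω‖ ≤ C) (hNA : OneStepNA P G Δ) :
    ∃ (x : Ω → (ι → ℝ)) (Q : Measure Ω), Measurable[G] x ∧ IsFiniteMeasure Q ∧ P ≪ Q ∧ Q ≪ P ∧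
      IsMartingaleIncrement Q G Δ ∧
      (∀ f : Ω → ℝ, Integrable f Q ↔
        Integrable (fun ω => Real.exp (-(x ω ⬝ᵥ Δ ω)) * f ω) P) ∧
      ∀ f : Ω → ℝ, ∫ ω, f ω ∂Q = ∫ ω, Real.exp (-(x ω ⬝ᵥ Δ ω)) * f ω ∂P := by
  obtain ⟨x, hx, hxi, hx0⟩ := hNA.exists_esscher hG hΔ hb
  obtain ⟨Q, hQ, hPQ, hQP, hint, hval⟩ := exists_measure_with_density
    (measurable_dotProduct (hx.mono hG le_rfl) hΔ).neg.exp (fun ω => Real.exp_pos _) hxi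
  refine ⟨x, Q, hx, hQ, hPQ, hQP, ⟨fun i => ?_, fun ζ hζ hζb => ?_⟩, hint, hval⟩
  · obtain ⟨C, hC⟩ := hb
    exact Integrable.of_bound ((measurable_pi_apply i).comp hΔ).aestronglyMeasurable C
      (ae_of_all _ fun ω => (norm_le_pi_norm (Δ ω) i).trans (hC ω))
  · rw [hval]
    exact hx0 ζ hζ hζb

/-- The density `S⁻¹` moves the scaling from the increment into the measure; `1 ≤ S` keeps it
bounded. -/
theorem IsMartingaleIncrement.exists_of_inv_smul [IsFiniteMeasure Q] {S : Ω → ℝ}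
    (hS : Measurable S) (hS1 : ∀ ω, 1 ≤ S ω)
    (h : IsMartingaleIncrement Q G fun ω => (S ω)⁻¹ • Δ ω) :
    ∃ Q' : Measure Ω, IsFiniteMeasure Q' ∧ Q ≪ Q' ∧ Q' ≪ Q ∧ IsMartingaleIncrement Q' G Δ ∧
      (∀ f : Ω → ℝ, Integrable f Q' ↔ Integrable (fun ω => (S ω)⁻¹ * f ω) Q) ∧
      ∀ f : Ω → ℝ, ∫ ω, f ω ∂Q' = ∫ ω, (S ω)⁻¹ * f ω ∂Q := by
  have hpos : ∀ ω, 0 < (S ω)⁻¹ := fun ω => inv_pos.2 (zero_lt_one.trans_le (hS1 ω))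
  have hint : Integrable (fun ω => (S ω)⁻¹) Q :=
    Integrable.of_bound hS.inv.aestronglyMeasurable 1 (ae_of_all _ fun ω => by
      rw [Real.norm_eq_abs, abs_of_pos (hpos ω)]
      exact inv_le_one_of_one_le₀ (hS1 ω))
  obtain ⟨Q', hQ', h1, h2, h3, h4⟩ := exists_measure_with_density (D := fun ω => (S ω)⁻¹) hS.inv hpos hint
  refine ⟨Q', hQ', h1, h2, ⟨fun i => (h3 _).2 (by simpa using h.integrable i),
    fun ζ hζ hζb => ?_⟩, h3, h4⟩
  rw [h4]
  simpa only [dotProduct_smul, smul_eq_mul] using h.integral_eq_zero ζ hζ hζb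

theorem norm_inv_smul_le_one {c r : ℝ} (x : ι → ℝ) (hr : 0 ≤ r) (hc : c = 1 + ‖x‖ + r) :
    ‖c⁻¹ • x‖ ≤ 1 := by
  have h0 := norm_nonneg x
  have hc0 : 0 < c := by linarith
  rw [norm_smul, norm_inv, Real.norm_of_nonneg hc0.le, inv_mul_le_iff₀ hc0]
  linarith

/-- One-period fundamental theorem of asset pricing, with an additional integrability
requirement. -/
theorem OneStepNA.exists_martingaleMeasure [IsFiniteMeasure P] (hG : G ≤ m) (hΔ : Measurable Δ)
    (hNA : OneStepNA P G Δ) {W : Ω → ℝ} (hW : Measurable W) :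
    ∃ Q : Measure Ω, IsFiniteMeasure Q ∧ P ≪ Q ∧ Q ≪ P ∧ IsMartingaleIncrement Q G Δ ∧
      Integrable W Q := by
  -- This scale bounds both `Δ / S` and `W / S`; the latter yields integrability of `W` once the
  -- scaling is undone.
  let S : Ω → ℝ := fun ω => 1 + ‖Δ ω‖ + |W ω|
  have hS : Measurable S := (measurable_const.add hΔ.norm).add hW.abs
  have hS1 : ∀ ω, 1 ≤ S ω := fun ω => by
    have := norm_nonneg (Δ ω)
    have := abs_nonneg (W ω)
    simp only [S]
    linarith
  have hpos : ∀ ω, 0 < S ω := fun ω => zero_lt_one.trans_le (hS1 ω)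
  obtain ⟨x, Q, -, hQ, hPQ, hQP, hmart, -, -⟩ := (hNA.inv_smul hpos).exists_esscher_measure hG
    (hS.inv.smul hΔ) ⟨1, fun ω => norm_inv_smul_le_one (Δ ω) (abs_nonneg (W ω)) rfl⟩
  obtain ⟨Q', hQ', h1, h2, h3, h4, -⟩ := hmart.exists_of_inv_smul hS hS1
  refine ⟨Q', hQ', hPQ.trans h1, h2.trans hQP, h3, (h4 W).2 ?_⟩
  refine Integrable.of_bound (hS.inv.mul hW).aestronglyMeasurable 1 (ae_of_all _ fun ω => ?_)
  rw [norm_mul, norm_inv, Real.norm_of_nonneg (hpos ω).le, Real.norm_eq_abs,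
    inv_mul_le_iff₀ (hpos ω)]
  have := norm_nonneg (Δ ω)
  simp only [S]
  linarith

end MartingaleMeasures

/-! ### One-period prices of an additional asset -/

section AdditionalAsset

variable {Ω : Type*} {d : ℕ} {G m : MeasurableSpace Ω} {P Q : Measure Ω}
  {Δ : Ω → (Fin d → ℝ)} {W Z Z' z : Ω → ℝ}

/-- The price increments obtained by adding an asset with price increment `W`. -/
def addAsset (Δ : Ω → (Fin d → ℝ)) (W : Ω → ℝ) : Ω → (Fin (d + 1) → ℝ) :=
  fun ω => Fin.snoc (Δ ω) (W ω)

theorem dotProduct_addAsset (ζ : Fin (d + 1) → ℝ) (ω : Ω) :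
    ζ ⬝ᵥ addAsset Δ W ω = (fun i : Fin d => ζ i.castSucc) ⬝ᵥ Δ ω + ζ (Fin.last d) * W ω := by
  simp [dotProduct, Fin.sum_univ_castSucc, addAsset]

theorem addAsset_dotProduct_addAsset (ζ : Ω → (Fin d → ℝ)) (c : Ω → ℝ) (ω : Ω) :
    addAsset ζ c ω ⬝ᵥ addAsset Δ W ω = ζ ω ⬝ᵥ Δ ω + c ω * W ω := by
  rw [dotProduct_addAsset]
  simp [addAsset]

theorem measurable_addAsset {mΩ : MeasurableSpace Ω} (hΔ : Measurable Δ) (hW : Measurable W) :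
    Measurable (addAsset Δ W) := by
  refine measurable_pi_iff.2 fun i => ?_
  refine Fin.lastCases ?_ (fun i => ?_) i
  · simpa [addAsset] using hW
  · simpa [addAsset, Function.comp_def] using (measurable_pi_apply i).comp hΔ

theorem norm_addAsset_le {C : ℝ} {ω : Ω} (hΔ : ‖Δ ω‖ ≤ C) (hW : |W ω| ≤ C) :
    ‖addAsset Δ W ω‖ ≤ C := by
  refine (pi_norm_le_iff_of_nonneg ((abs_nonneg _).trans hW)).2 fun i => ?_
  refine Fin.lastCases ?_ (fun i => ?_) i
  · simpa [addAsset] using hW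
  · simpa [addAsset] using (norm_le_pi_norm (Δ ω) i).trans hΔ

theorem measurable_init {mΩ : MeasurableSpace Ω} {ζ : Ω → (Fin (d + 1) → ℝ)} (hζ : Measurable ζ) :
    Measurable fun ω => fun i : Fin d => ζ ω i.castSucc :=
  measurable_pi_iff.2 fun i => (measurable_pi_apply i.castSucc).comp hζ

theorem norm_init_le (ζ : Fin (d + 1) → ℝ) : ‖fun i : Fin d => ζ i.castSucc‖ ≤ ‖ζ‖ :=
  (pi_norm_le_iff_of_nonneg (norm_nonneg _)).2 fun i => norm_le_pi_norm ζ i.castSucc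

theorem OneStepNA.of_addAsset (h : OneStepNA P G (addAsset Δ W)) : OneStepNA P G Δ := by
  intro ζ hζ h0
  have := h (addAsset ζ fun _ => 0) (measurable_addAsset hζ measurable_const)
    (by simpa only [addAsset_dotProduct_addAsset, zero_mul, add_zero] using h0)
  simpa only [addAsset_dotProduct_addAsset, zero_mul, add_zero] using this

theorem OneStepNA.addAsset_neg (h : OneStepNA P G (addAsset Δ W)) :
    OneStepNA P G (addAsset Δ fun ω => -W ω) := by
  intro ζ hζ h0
  have hm : Measurable[G] (addAsset (fun ω i => ζ ω (Fin.castSucc i)) fun ω => -ζ ω (Fin.last d)) :=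
    measurable_addAsset (measurable_init hζ) ((measurable_pi_apply (Fin.last d)).comp hζ).neg
  have heq : ∀ ω, addAsset (fun ω i => ζ ω (Fin.castSucc i)) (fun ω => -ζ ω (Fin.last d)) ω ⬝ᵥ
      addAsset Δ W ω = ζ ω ⬝ᵥ addAsset Δ (fun ω => -W ω) ω := fun ω => by
    rw [addAsset_dotProduct_addAsset, dotProduct_addAsset, neg_mul, mul_neg]
  simpa only [heq] using h _ hm (by simpa only [heq] using h0)

theorem IsMartingaleIncrement.of_addAsset (h : IsMartingaleIncrement Q G (addAsset Δ W)) :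
    IsMartingaleIncrement Q G Δ := by
  refine ⟨fun i => by simpa [addAsset] using h.integrable i.castSucc, fun ζ hζ hb => ?_⟩
  obtain ⟨C, hC⟩ := hb
  have := h.integral_eq_zero (addAsset ζ fun _ => 0) (measurable_addAsset hζ measurable_const)
    ⟨C, fun ω => norm_addAsset_le (hC ω) (by simpa using (norm_nonneg _).trans (hC ω))⟩
  simpa only [addAsset_dotProduct_addAsset, zero_mul, add_zero] using this

theorem IsMartingaleIncrement.setIntegral_eq_zero (h : IsMartingaleIncrement Q G (addAsset Δ W))
    (hG : G ≤ m) {A : Set Ω} (hA : MeasurableSet[G] A) : ∫ ω in A, W ω ∂Q = 0 := by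
  have := h.integral_eq_zero (addAsset (fun _ => 0) (A.indicator fun _ => 1))
    (measurable_addAsset measurable_const (measurable_const.indicator hA))
    ⟨1, fun ω => norm_addAsset_le (by simp) (by by_cases hω : ω ∈ A <;> simp [hω])⟩
  rw [← integral_indicator (hG _ hA), ← this]
  congr 1
  ext ω
  by_cases hω : ω ∈ A <;> simp [addAsset_dotProduct_addAsset, hω]

/-- Pricing by conditional expectation: a bounded holding known at the start can be pulled out of
it, so trading the new asset has mean zero. -/
theorem IsMartingaleIncrement.addAsset_sub_condExp [IsFiniteMeasure Q]
    (h : IsMartingaleIncrement Q G Δ) (hG : G ≤ m) (hZ : Integrable Z Q) :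
    IsMartingaleIncrement Q G (addAsset Δ fun ω => Z ω - (Q[Z|G]) ω) := by
  have hint : Integrable (fun ω => Z ω - (Q[Z|G]) ω) Q := hZ.sub integrable_condExp
  refine ⟨fun i => ?_, fun ζ hζ hb => ?_⟩
  · refine Fin.lastCases ?_ (fun i => ?_) i
    · simpa [addAsset] using hint
    · simpa [addAsset] using h.integrable i
  · obtain ⟨C, hC⟩ := hb
    have hinit : ∃ C, ∀ ω, ‖fun i : Fin d => ζ ω i.castSucc‖ ≤ C :=
      ⟨C, fun ω => (norm_init_le _).trans (hC ω)⟩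
    set c : Ω → ℝ := fun ω => ζ ω (Fin.last d)
    have hc : Measurable[G] c := (measurable_pi_apply (Fin.last d)).comp hζ
    have hcm : AEStronglyMeasurable c Q := (hc.mono hG le_rfl).aestronglyMeasurable
    have hcb : ∀ᵐ ω ∂Q, ‖c ω‖ ≤ C := ae_of_all _ fun ω => (norm_le_pi_norm (ζ ω) _).trans (hC ω)
    have hcZ : Integrable (fun ω => c ω * Z ω) Q := hZ.bdd_mul hcm hcb
    have hcE : Integrable (fun ω => c ω * (Q[Z|G]) ω) Q := integrable_condExp.bdd_mul hcm hcb
    have hpull : Q[fun ω => c ω * Z ω|G] =ᵐ[Q] fun ω => c ω * (Q[Z|G]) ω :=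
      condExp_mul_of_stronglyMeasurable_left hc.stronglyMeasurable hcZ hZ
    have h1 : ∫ ω, c ω * Z ω ∂Q = ∫ ω, c ω * (Q[Z|G]) ω ∂Q := by
      rw [← integral_condExp hG]
      exact integral_congr_ae hpull
    simp only [dotProduct_addAsset]
    rw [integral_add (h.integrable_dotProduct hG (measurable_init hζ) hinit)
      (hint.bdd_mul hcm hcb), h.integral_eq_zero _ (measurable_init hζ) hinit, zero_add]
    simp only [mul_sub]
    rw [integral_sub hcZ hcE, h1, sub_self]

/-- A contingent claim at the end of a period has an arbitrage-free price at its beginning. -/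
theorem OneStepNA.exists_price [IsFiniteMeasure P] (hG : G ≤ m) (hΔ : Measurable Δ)
    (hNA : OneStepNA P G Δ) (hZ : Measurable Z) :
    ∃ z : Ω → ℝ, Measurable[G] z ∧ OneStepNA P G (addAsset Δ fun ω => Z ω - z ω) := by
  obtain ⟨Q, hQ, hPQ, hQP, hmart, hZi⟩ := hNA.exists_martingaleMeasure hG hΔ hZ
  exact ⟨Q[Z|G], stronglyMeasurable_condExp.measurable,
    (hmart.addAsset_sub_condExp hG hZi).oneStepNA hG hPQ hQP⟩

/-- A cheaper claim at the end of a period has a cheaper price at its beginning. -/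
theorem OneStepNA.exists_price_lt_of_lt [IsFiniteMeasure P] (hG : G ≤ m) (hΔ : Measurable Δ)
    (hZ : Measurable Z) (hz : Measurable[G] z)
    (hNA : OneStepNA P G (addAsset Δ fun ω => Z ω - z ω)) (hZ' : Measurable Z')
    (hle : Z' ≤ᵐ[P] Z) (hne : ¬ Z' =ᵐ[P] Z) :
    ∃ z' : Ω → ℝ, Measurable[G] z' ∧ OneStepNA P G (addAsset Δ fun ω => Z' ω - z' ω) ∧
      z' ≤ᵐ[P] z ∧ ¬ z' =ᵐ[P] z := by
  have hzm := hz.mono hG le_rfl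
  have hWm : Measurable fun ω => Z ω - z ω := hZ.sub hzm
  obtain ⟨Q, hQ, hPQ, hQP, hmart, hi⟩ := hNA.exists_martingaleMeasure hG
    (measurable_addAsset hΔ hWm) (hZ.abs.add hZ'.abs)
  have hZi : Integrable Z Q := hi.mono' hZ.aestronglyMeasurable (ae_of_all _ fun ω => by
    simp only [Pi.add_apply, Real.norm_eq_abs]
    linarith [abs_nonneg (Z' ω)])
  have hZi' : Integrable Z' Q := hi.mono' hZ'.aestronglyMeasurable (ae_of_all _ fun ω => by
    simp only [Pi.add_apply, Real.norm_eq_abs]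
    linarith [abs_nonneg (Z ω)])
  have hWi : Integrable (fun ω => Z ω - z ω) Q := by
    simpa [addAsset] using hmart.integrable (Fin.last d)
  have hzi : Integrable z Q := (hZi.sub hWi).congr (ae_of_all _ fun ω => by simp)
  have hset : ∀ A, MeasurableSet[G] A → ∫ ω in A, z ω ∂Q = ∫ ω in A, Z ω ∂Q := fun A hA => by
    have := hmart.setIntegral_eq_zero hG hA
    rw [integral_sub hZi.integrableOn hzi.integrableOn] at this
    linarith
  -- `Q` is a martingale measure for the market that includes the old asset, so `z` is the
  -- conditional expectation of `Z`. Pricing `Z'` under the same `Q` makes the two prices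
  -- comparable.
  have hzE : z =ᵐ[Q] Q[Z|G] :=
    ae_eq_condExp_of_forall_setIntegral_eq hG hZi (fun _ _ _ => hzi.integrableOn)
      (fun A hA _ => hset A hA) hz.stronglyMeasurable.aestronglyMeasurable
  have hle' : Z' ≤ᵐ[Q] Z := hQP.ae_le hle
  refine ⟨Q[Z'|G], stronglyMeasurable_condExp.measurable,
    (hmart.of_addAsset.addAsset_sub_condExp hG hZi').oneStepNA hG hPQ hQP, hPQ.ae_le ?_,
    fun heq => hne (hPQ.ae_le ?_)⟩
  · filter_upwards [hzE, condExp_mono (m := G) hZi' hZi hle'] with ω h1 h2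
    rw [h1]
    exact h2
  · have h1 : ∫ ω, Z' ω ∂Q = ∫ ω, Z ω ∂Q := by
      rw [← integral_condExp hG (f := Z'), integral_congr_ae (hQP.ae_le heq),
        integral_congr_ae hzE, integral_condExp hG]
    exact (integral_eq_iff_of_ae_le hZi' hZi hle').1 h1

/-- Absence of arbitrage can be checked separately on an event known at the beginning. -/
theorem OneStepNA.piecewise {ι : Type*} [Fintype ι] {Δ₁ Δ₂ Δ₃ : Ω → (ι → ℝ)}
    (h₁ : OneStepNA P G Δ₁) (h₂ : OneStepNA P G Δ₂) {B : Set Ω} (hB : MeasurableSet[G] B)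
    (heq₁ : ∀ ω ∈ B, Δ₃ ω = Δ₁ ω) (heq₂ : ∀ ω ∉ B, Δ₃ ω = Δ₂ ω) : OneStepNA P G Δ₃ := by
  intro ζ hζ h0
  have h3 := h₁ (B.indicator ζ) (hζ.indicator hB) (by
    filter_upwards [h0] with ω hω
    by_cases h : ω ∈ B
    · rwa [Set.indicator_of_mem h, ← heq₁ ω h]
    · simp [Set.indicator_of_notMem h])
  have h4 := h₂ (Bᶜ.indicator ζ) (hζ.indicator hB.compl) (by
    filter_upwards [h0] with ω hω
    by_cases h : ω ∈ B
    · simp [h]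
    · rwa [Set.indicator_of_mem (show ω ∈ Bᶜ from h), ← heq₂ ω h])
  filter_upwards [h3, h4] with ω h5 h6
  by_cases h : ω ∈ B
  · rwa [Set.indicator_of_mem h, ← heq₁ ω h] at h5
  · rwa [Set.indicator_of_mem (show ω ∈ Bᶜ from h), ← heq₂ ω h] at h6

theorem exp_sub_one_mul_self_nonneg (u : ℝ) : 0 ≤ (Real.exp u - 1) * u := by
  rcases le_total 0 u with h | h
  · exact mul_nonneg (sub_nonneg.2 (Real.one_le_exp h)) h
  · exact mul_nonneg_of_nonpos_of_nonpos (sub_nonpos.2 (Real.exp_le_one_iff.2 h)) h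

/-- If the claim `W` cannot be replicated within the period, some martingale measure gives it a
negative conditional value on an event of positive probability. -/
theorem OneStepNA.exists_martingaleMeasure_setIntegral_neg [IsFiniteMeasure P] (hG : G ≤ m)
    (hΔ : Measurable Δ) (hW : Measurable W) (hNA : OneStepNA P G (addAsset Δ W))
    (hnr : ¬ ∃ x : Ω → (Fin d → ℝ), Measurable[G] x ∧ ∀ᵐ ω ∂P, W ω = x ω ⬝ᵥ Δ ω) :
    ∃ Q : Measure Ω, IsFiniteMeasure Q ∧ P ≪ Q ∧ Q ≪ P ∧ IsMartingaleIncrement Q G Δ ∧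
      Integrable W Q ∧ ∃ A, MeasurableSet[G] A ∧ ∫ ω in A, W ω ∂Q < 0 := by
  let S : Ω → ℝ := fun ω => 1 + ‖Δ ω‖ + |W ω|
  have hS : Measurable S := (measurable_const.add hΔ.norm).add hW.abs
  have hS1 : ∀ ω, 1 ≤ S ω := fun ω => by
    have := norm_nonneg (Δ ω)
    have := abs_nonneg (W ω)
    simp only [S]
    linarith
  have hpos : ∀ ω, 0 < S ω := fun ω => zero_lt_one.trans_le (hS1 ω)
  let Δ' : Ω → (Fin d → ℝ) := fun ω => (S ω)⁻¹ • Δ ω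
  let W' : Ω → ℝ := fun ω => (S ω)⁻¹ * W ω
  have hΔ'm : Measurable Δ' := hS.inv.smul hΔ
  have hW'm : Measurable W' := hS.inv.mul hW
  have hΔ'b : ∀ ω, ‖Δ' ω‖ ≤ 1 := fun ω => norm_inv_smul_le_one (Δ ω) (abs_nonneg (W ω)) rfl
  have hW'b : ∀ ω, |W' ω| ≤ 1 := fun ω => by
    simp only [W']
    rw [abs_mul, abs_inv, abs_of_pos (hpos ω), inv_mul_le_iff₀ (hpos ω)]
    have := norm_nonneg (Δ ω)
    simp only [S]
    linarith
  have heq : (fun ω => (S ω)⁻¹ • addAsset Δ W ω) = addAsset Δ' W' := by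
    ext ω i
    refine Fin.lastCases ?_ (fun i => ?_) i <;> simp [addAsset, Δ', W']
  have hNA' : OneStepNA P G (addAsset Δ' W') := heq ▸ hNA.inv_smul hpos
  obtain ⟨-, Q₁, -, hQ₁, hPQ₁, hQ₁P, hmart₁, -, -⟩ := hNA'.exists_esscher_measure hG
    (measurable_addAsset hΔ'm hW'm) ⟨1, fun ω => norm_addAsset_le (hΔ'b ω) (hW'b ω)⟩
  have hexpW : Integrable (fun ω => Real.exp (-W' ω)) Q₁ :=
    Integrable.of_bound hW'm.neg.exp.aestronglyMeasurable (Real.exp 1) (ae_of_all _ fun ω => by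
      rw [Real.norm_eq_abs, Real.abs_exp]
      exact Real.exp_le_exp.2 (by linarith [(abs_le.1 (hW'b ω)).1]))
  -- The tilt by `exp (-W')` favours low values of `W'` but spoils the martingale property of `Δ'`;
  -- a second Esscher transform restores it. Relative to `Q₁` the total density is `exp u`.
  obtain ⟨R, hR, hQR, hRQ, hRint, hRval⟩ := exists_measure_with_density
    (D := fun ω => Real.exp (-W' ω)) hW'm.neg.exp (fun ω => Real.exp_pos _) hexpW
  obtain ⟨x, Q₂, hx, hQ₂, hRQ₂, hQ₂R, hmart₂, hint₂, hval₂⟩ :=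
    (hNA'.of_addAsset.of_ac (hPQ₁.trans hQR) (hRQ.trans hQ₁P)).exists_esscher_measure hG hΔ'm
      ⟨1, hΔ'b⟩
  let u : Ω → ℝ := fun ω => -W' ω - x ω ⬝ᵥ Δ' ω
  have hmul : ∀ (f : Ω → ℝ) ω, Real.exp (-W' ω) * (Real.exp (-(x ω ⬝ᵥ Δ' ω)) * f ω) =
      Real.exp (u ω) * f ω := fun f ω => by
    rw [← mul_assoc, ← Real.exp_add]
    rfl
  have hint : ∀ f : Ω → ℝ, Integrable f Q₂ ↔ Integrable (fun ω => Real.exp (u ω) * f ω) Q₁ :=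
    fun f => by
      rw [hint₂, hRint]
      simp only [hmul]
  have hval : ∀ f : Ω → ℝ, ∫ ω, f ω ∂Q₂ = ∫ ω, Real.exp (u ω) * f ω ∂Q₁ := fun f => by
    rw [hval₂, hRval]
    simp only [hmul]
  have hW'i : Integrable W' Q₂ := Integrable.of_bound hW'm.aestronglyMeasurable 1
    (ae_of_all _ hW'b)
  obtain ⟨n, hn⟩ : ∃ n : ℕ, ∫ ω in {ω | ‖x ω‖ ≤ n}, W' ω ∂Q₂ < 0 := by
    -- If `W'` has nonnegative integral on each truncation event `A`, then `∫ u` over `A` is zero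
    -- under `Q₁` and at most zero under `Q₂`. So `(exp u - 1) * u`, which is nonnegative, has zero
    -- integral and `u = 0`: thus `W' = -x · Δ'`, a replication.
    by_contra! hcon
    have hu0 : ∀ n : ℕ, ∀ᵐ ω ∂Q₁, {ω | ‖x ω‖ ≤ n}.indicator u ω = 0 := fun n => by
      let A : Set Ω := {ω | ‖x ω‖ ≤ n}
      have hA : MeasurableSet[G] A := measurableSet_norm_le hx n
      have hxA : Measurable[G] (A.indicator x) := hx.indicator hA
      have hxb : ∃ C, ∀ ω, ‖A.indicator x ω‖ ≤ C := ⟨n, norm_indicator_norm_le x n⟩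
      have hsplit : ∀ ω, A.indicator u ω = -(A.indicator W' ω) - A.indicator x ω ⬝ᵥ Δ' ω :=
        fun ω => by
          by_cases h : ω ∈ A
          · simp only [Set.indicator_of_mem h, u]
          · simp [Set.indicator_of_notMem h]
      have hAW : ∀ {μ : Measure Ω}, Integrable W' μ → Integrable (A.indicator W') μ :=
        fun h => h.indicator (hG _ hA)
      have hW'i₁ : Integrable W' Q₁ := Integrable.of_bound hW'm.aestronglyMeasurable 1
        (ae_of_all _ hW'b)
      have hAWn : ∀ {μ : Measure Ω}, Integrable W' μ →
          Integrable (fun ω => -(A.indicator W' ω)) μ := fun h => (hAW h).neg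
      have hAu₁ : Integrable (A.indicator u) Q₁ := by
        have h1 := hmart₁.of_addAsset.integrable_dotProduct hG hxA hxb
        exact ((hAW hW'i₁).neg.sub h1).congr (ae_of_all _ fun ω => (hsplit ω).symm)
      have hAu₂ : Integrable (A.indicator u) Q₂ := by
        have h1 := hmart₂.integrable_dotProduct hG hxA hxb
        exact ((hAW hW'i).neg.sub h1).congr (ae_of_all _ fun ω => (hsplit ω).symm)
      have hI₁ : ∫ ω, A.indicator u ω ∂Q₁ = 0 := by
        simp only [hsplit]
        rw [integral_sub (hAWn hW'i₁) (hmart₁.of_addAsset.integrable_dotProduct hG hxA hxb),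
          integral_neg, integral_indicator (hG _ hA), hmart₁.setIntegral_eq_zero hG hA,
          hmart₁.of_addAsset.integral_eq_zero _ hxA hxb, neg_zero, sub_zero]
      have hI₂ : ∫ ω, A.indicator u ω ∂Q₂ ≤ 0 := by
        simp only [hsplit]
        rw [integral_sub (hAWn hW'i) (hmart₂.integrable_dotProduct hG hxA hxb),
          integral_neg, integral_indicator (hG _ hA), hmart₂.integral_eq_zero _ hxA hxb, sub_zero]
        exact neg_nonpos.2 (hcon n)
      rw [hval] at hI₂
      rw [hint] at hAu₂
      have hnn : ∀ ω, 0 ≤ Real.exp (u ω) * A.indicator u ω - A.indicator u ω := fun ω => by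
        by_cases h : ω ∈ A
        · rw [Set.indicator_of_mem h]
          linarith [exp_sub_one_mul_self_nonneg (u ω)]
        · simp [Set.indicator_of_notMem h]
      have hI₃ : ∫ ω, (Real.exp (u ω) * A.indicator u ω - A.indicator u ω) ∂Q₁ = 0 := by
        refine le_antisymm ?_ (integral_nonneg hnn)
        rw [integral_sub hAu₂ hAu₁, hI₁, sub_zero]
        exact hI₂
      filter_upwards [(integral_eq_zero_iff_of_nonneg hnn (hAu₂.sub hAu₁)).1 hI₃] with ω hω
      by_cases h : ω ∈ A
      · change A.indicator u ω = 0
        simp only [Set.indicator_of_mem h, Pi.zero_apply] at hω ⊢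
        have h1 : (Real.exp (u ω) - 1) * u ω = 0 := by linarith
        rcases mul_eq_zero.1 h1 with h2 | h2
        · exact Real.exp_eq_one_iff _ |>.1 (sub_eq_zero.1 h2)
        · exact h2
      · exact Set.indicator_of_notMem h _
    refine hnr ⟨fun ω => -x ω, hx.neg, hPQ₁.ae_le ?_⟩
    filter_upwards [ae_all_iff.2 hu0] with ω hω
    obtain ⟨n, hn⟩ := exists_nat_ge ‖x ω‖
    have h1 := hω n
    rw [Set.indicator_of_mem (show ω ∈ {ω | ‖x ω‖ ≤ n} from hn)] at h1
    simp only [u, W', Δ', dotProduct_smul, smul_eq_mul] at h1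
    have h2 : (S ω)⁻¹ * (W ω + x ω ⬝ᵥ Δ ω) = 0 := by linarith
    rw [neg_dotProduct]
    rcases mul_eq_zero.1 h2 with h3 | h3
    · exact absurd h3 (inv_pos.2 (hpos ω)).ne'
    · linarith
  obtain ⟨Q, hQ, h1, h2, hmart, h4, h5⟩ := hmart₂.exists_of_inv_smul hS hS1
  have hA : MeasurableSet[G] {ω | ‖x ω‖ ≤ n} := measurableSet_norm_le hx n
  refine ⟨Q, hQ, ((hPQ₁.trans hQR).trans hRQ₂).trans h1,
    ((h2.trans hQ₂R).trans hRQ).trans hQ₁P, hmart, (h4 W).2 hW'i, _, hA, ?_⟩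
  rw [← integral_indicator (hG _ hA), h5]
  rw [← integral_indicator (hG _ hA)] at hn
  convert hn using 3 with ω
  by_cases h : ω ∈ {ω | ‖x ω‖ ≤ n}
  · simp only [Set.indicator_of_mem h, W']
  · simp only [Set.indicator_of_notMem h, mul_zero]

/-- A claim that cannot be replicated within the period admits a cheaper arbitrage-free price. -/
theorem OneStepNA.exists_price_lt_of_not_replicable [IsFiniteMeasure P] (hG : G ≤ m)
    (hΔ : Measurable Δ) (hZ : Measurable Z) (hz : Measurable[G] z)
    (hNA : OneStepNA P G (addAsset Δ fun ω => Z ω - z ω))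
    (hnr : ¬ ∃ x : Ω → (Fin d → ℝ), Measurable[G] x ∧ ∀ᵐ ω ∂P, Z ω - z ω = x ω ⬝ᵥ Δ ω) :
    ∃ z' : Ω → ℝ, Measurable[G] z' ∧ OneStepNA P G (addAsset Δ fun ω => Z ω - z' ω) ∧
      z' ≤ᵐ[P] z ∧ ¬ z' =ᵐ[P] z := by
  have hWm : Measurable fun ω => Z ω - z ω := hZ.sub (hz.mono hG le_rfl)
  obtain ⟨Q, hQ, hPQ, hQP, hmart, hi, A, hA, hneg⟩ :=
    hNA.exists_martingaleMeasure_setIntegral_neg hG hΔ hWm hnr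
  set E : Ω → ℝ := Q[fun ω => Z ω - z ω|G]
  have hE : Measurable[G] E := stronglyMeasurable_condExp.measurable
  -- The price is lowered to its value under `Q` only where that is cheaper. If this changed
  -- nothing, `E` would be nonnegative, against the negative integral over `A`.
  have hB : MeasurableSet[G] {ω | E ω < 0} := hE measurableSet_Iio
  refine ⟨fun ω => z ω + {ω | E ω < 0}.indicator E ω, hz.add (hE.indicator hB), ?_,
    ae_of_all _ fun ω => ?_, fun heq => ?_⟩
  · refine ((hmart.addAsset_sub_condExp hG hi).oneStepNA hG hPQ hQP).piecewise hNA hB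
      (fun ω h => ?_) (fun ω h => ?_)
    · simp only [addAsset, Set.indicator_of_mem h, E, sub_sub]
    · simp only [addAsset, Set.indicator_of_notMem h, add_zero]
  · by_cases h : ω ∈ {ω | E ω < 0}
    · simp only [Set.indicator_of_mem h]
      linarith [show E ω < 0 from h]
    · simp [Set.indicator_of_notMem h]
  · refine hneg.not_ge ?_
    rw [← setIntegral_condExp hG hi hA]
    refine integral_nonneg_of_ae (ae_restrict_of_ae (hQP.ae_le ?_))
    filter_upwards [heq] with ω hω
    by_contra hlt
    have h : ω ∈ {ω | E ω < 0} := not_le.1 hlt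
    rw [Set.indicator_of_mem h] at hω
    exact (show E ω < 0 from h).ne (by linarith)

end AdditionalAsset

/-! ### From one period to the whole time horizon -/

section MultiPeriod

variable {Ω : Type*} {m : MeasurableSpace Ω} {P : Measure Ω} {T d : ℕ}
  {ℱ : Filtration (Fin (T + 1)) m} {X : Fin (T + 1) → Ω → (Fin d → ℝ)}
  {Y Y' : Fin (T + 1) → Ω → ℝ} {ξ : Fin T → Ω → (Fin d → ℝ)} {t : Fin (T + 1)} {H p : Ω → ℝ}

/-- The price increment of the `k`-th trading period. -/
def increment (X : Fin (T + 1) → Ω → (Fin d → ℝ)) (k : Fin T) : Ω → (Fin d → ℝ) :=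
  fun ω => X k.succ ω - X k.castSucc ω

theorem gains_zero (ω : Ω) : gains X ξ 0 ω = 0 := by
  simp [gains]

theorem gains_succ (k : Fin T) (ω : Ω) :
    gains X ξ k.succ ω = gains X ξ k.castSucc ω + ξ k ω ⬝ᵥ increment X k ω := by
  have h : (Finset.univ.filter fun j : Fin T => j.succ ≤ k.succ) =
      insert k (Finset.univ.filter fun j : Fin T => j.succ ≤ k.castSucc) := by
    ext j
    simp only [Finset.mem_filter, Finset.mem_univ, true_and, Finset.mem_insert, Fin.le_def,
      Fin.val_succ, Fin.val_castSucc, Fin.ext_iff]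
    omega
  rw [gains, h, Finset.sum_insert (by simp [Fin.le_def]), add_comm]
  rfl

theorem measurable_increment (hX : ∀ s, Measurable[ℱ s] (X s)) (k : Fin T) :
    Measurable (increment X k) :=
  ((hX k.succ).mono (ℱ.le _) le_rfl).sub ((hX k.castSucc).mono (ℱ.le _) le_rfl)

theorem measurable_gains (hX : ∀ s, Measurable[ℱ s] (X s)) (hξ : IsPredictable ℱ ξ)
    (s : Fin (T + 1)) : Measurable[ℱ s] (gains X ξ s) := by
  refine Finset.measurable_sum (m := ℱ s) _ fun k hk => ?_
  have hks := (Finset.mem_filter.1 hk).2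
  have hks' : k.castSucc ≤ s := (Fin.castSucc_lt_succ).le.trans hks
  exact measurable_dotProduct (mΩ := ℱ s) ((hξ k).mono (ℱ.mono hks') le_rfl)
    (Measurable.sub (m := ℱ s) ((hX _).mono (ℱ.mono hks) le_rfl)
      ((hX _).mono (ℱ.mono hks') le_rfl))

theorem IsArbitrageFree.oneStepNA (h : IsArbitrageFree P ℱ X) (k : Fin T) :
    OneStepNA P (ℱ k.castSucc) (increment X k) := by
  intro ζ hζ h0
  have hgains : ∀ ω, gains X (Function.update (fun _ _ => 0) k ζ) (Fin.last T) ω =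
      ζ ω ⬝ᵥ increment X k ω := fun ω => by
    rw [gains, Finset.sum_eq_single k]
    · rw [Function.update_self]
      rfl
    · intro j _ hj
      rw [Function.update_of_ne hj, zero_dotProduct]
    · intro hk
      exact absurd (Finset.mem_filter.2 ⟨Finset.mem_univ k, Fin.le_last _⟩) hk
  by_contra hne
  refine h ⟨Function.update (fun _ _ => 0) k ζ, fun j => ?_, by simpa only [hgains] using h0,
    pos_iff_ne_zero.2 fun hz => hne ?_⟩
  · rcases eq_or_ne j k with rfl | hj
    · rwa [Function.update_self]
    · rw [Function.update_of_ne hj]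
      exact measurable_const
  · simp only [hgains] at hz
    have hz' : ∀ᵐ ω ∂P, ¬ 0 < ζ ω ⬝ᵥ increment X k ω := measure_eq_zero_iff_ae_notMem.1 hz
    filter_upwards [h0, hz'] with ω h1 h2
    exact le_antisymm (not_lt.1 h2) h1

/-- Suppose the gain at `k + 1` is nonnegative. Trading in the last period only where the gain at
`k` is at most zero earns a nonnegative amount, hence nothing. So the gain at `k` was nonnegative,
and is zero by induction. -/
theorem isArbitrageFree_of_oneStepNA (hX : ∀ s, Measurable[ℱ s] (X s))
    (h : ∀ k : Fin T, OneStepNA P (ℱ k.castSucc) (increment X k)) : IsArbitrageFree P ℱ X := by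
  have key : ∀ (t : Fin (T + 1)) (ξ : Fin T → Ω → (Fin d → ℝ)), IsPredictable ℱ ξ →
      (∀ᵐ ω ∂P, 0 ≤ gains X ξ t ω) → ∀ᵐ ω ∂P, gains X ξ t ω = 0 := by
    intro t ξ hξ
    induction t using Fin.induction with
    | zero => exact fun _ => ae_of_all _ gains_zero
    | succ k ih =>
      intro h0
      let A : Set Ω := {ω | gains X ξ k.castSucc ω ≤ 0}
      have hA : MeasurableSet[ℱ k.castSucc] A := measurable_gains hX hξ _ measurableSet_Iic
      have h1 := h k (A.indicator (ξ k)) ((hξ k).indicator hA) (by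
        filter_upwards [h0] with ω hω
        rw [gains_succ] at hω
        by_cases hωA : ω ∈ A
        · rw [Set.indicator_of_mem hωA]
          linarith [show gains X ξ k.castSucc ω ≤ 0 from hωA]
        · rw [Set.indicator_of_notMem hωA, zero_dotProduct])
      have h2 := ih (by
        filter_upwards [h0, h1] with ω hω hω1
        rw [gains_succ] at hω
        by_cases hωA : ω ∈ A
        · rw [Set.indicator_of_mem hωA] at hω1
          linarith
        · exact (not_le.1 hωA).le)
      filter_upwards [h1, h2] with ω hω1 hω2
      rw [Set.indicator_of_mem (show ω ∈ A from hω2.le)] at hω1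
      rw [gains_succ, hω1, hω2, add_zero]
  rintro ⟨ξ, hξ, h0, hpos⟩
  refine hpos.ne' (measure_eq_zero_iff_ae_notMem.2 ?_)
  filter_upwards [key _ ξ hξ h0] with ω hω
  exact fun h' => (show 0 < gains X ξ (Fin.last T) ω from h').ne' hω

theorem increment_extendMarket (k : Fin T) :
    increment (extendMarket X Y) k =
      addAsset (increment X k) fun ω => Y k.succ ω - Y k.castSucc ω := by
  ext ω i
  refine Fin.lastCases ?_ (fun i => ?_) i <;> simp [increment, extendMarket, addAsset]

/-- The market extended by the price process `Y` has no arbitrage in any single trading period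
starting at time `t` or later. -/
def ExtensionNAFrom (P : Measure Ω) (ℱ : Filtration (Fin (T + 1)) m)
    (X : Fin (T + 1) → Ω → (Fin d → ℝ)) (Y : Fin (T + 1) → Ω → ℝ) (t : Fin (T + 1)) : Prop :=
  ∀ k : Fin T, t ≤ k.castSucc → OneStepNA P (ℱ k.castSucc)
    (addAsset (increment X k) fun ω => Y k.succ ω - Y k.castSucc ω)

theorem isArbitrageFree_extendMarket_iff (hX : ∀ s, Measurable[ℱ s] (X s))
    (hY : ∀ s, Measurable[ℱ s] (Y s)) :
    IsArbitrageFree P ℱ (extendMarket X Y) ↔ ExtensionNAFrom P ℱ X Y 0 := by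
  constructor
  · intro h k _
    rw [← increment_extendMarket]
    exact h.oneStepNA k
  · intro h
    refine isArbitrageFree_of_oneStepNA (fun s => measurable_addAsset (hX s) (hY s)) fun k => ?_
    rw [increment_extendMarket]
    exact h k (Fin.zero_le _)

theorem measurable_update (hY : ∀ s, Measurable[ℱ s] (Y s)) {z : Ω → ℝ} (hz : Measurable[ℱ t] z)
    (s : Fin (T + 1)) : Measurable[ℱ s] (Function.update Y t z s) := by
  rcases eq_or_ne s t with rfl | h
  · rwa [Function.update_self]
  · rw [Function.update_of_ne h]
    exact hY s

/-- Among periods starting at `k` or later, only the `k`-th sees the price at time `k`. This is what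
permits backward recursion. -/
theorem ExtensionNAFrom.update {k : Fin T} (h : ExtensionNAFrom P ℱ X Y k.succ) {z : Ω → ℝ}
    (hz : OneStepNA P (ℱ k.castSucc) (addAsset (increment X k) fun ω => Y k.succ ω - z ω)) :
    ExtensionNAFrom P ℱ X (Function.update Y k.castSucc z) k.castSucc := by
  intro j hj
  have hj1 : j.succ ≠ k.castSucc := by
    rw [ne_eq, Fin.ext_iff]
    simp only [Fin.le_def, Fin.val_castSucc, Fin.val_succ] at hj ⊢
    omega
  rcases eq_or_ne j k with rfl | hjk
  · simpa only [Function.update_self, Function.update_of_ne hj1] using hz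
  · have hj2 : j.castSucc ≠ k.castSucc := fun h' => hjk (Fin.castSucc_injective _ h')
    have hkj : k.succ ≤ j.castSucc := by
      simp only [ne_eq, Fin.ext_iff, Fin.le_def, Fin.val_castSucc, Fin.val_succ] at hj hjk ⊢
      omega
    simpa only [Function.update_of_ne hj1, Function.update_of_ne hj2] using h j hkj

theorem ExtensionNAFrom.mono {s : Fin (T + 1)} (h : ExtensionNAFrom P ℱ X Y t) (hts : t ≤ s) :
    ExtensionNAFrom P ℱ X Y s :=
  fun k hk => h k (hts.trans hk)

/-- An arbitrage-free price process on `{s, …, T}` extends to one on `{0, …, T}`. -/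
theorem ExtensionNAFrom.exists_extension [IsFiniteMeasure P] (hX : ∀ s, Measurable[ℱ s] (X s))
    (hNA : IsArbitrageFree P ℱ X) (s : Fin (T + 1)) :
    ∀ Y : Fin (T + 1) → Ω → ℝ, (∀ r, Measurable[ℱ r] (Y r)) → ExtensionNAFrom P ℱ X Y s →
      ∃ Y' : Fin (T + 1) → Ω → ℝ, (∀ r, Measurable[ℱ r] (Y' r)) ∧ (∀ r, s ≤ r → Y' r = Y r) ∧
        ExtensionNAFrom P ℱ X Y' 0 := by
  induction s using Fin.induction with
  | zero => exact fun Y hY h => ⟨Y, hY, fun _ _ => rfl, h⟩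
  | succ k ih =>
    intro Y hY h
    obtain ⟨z, hz, hzNA⟩ := (hNA.oneStepNA k).exists_price (ℱ.le _) (measurable_increment hX k)
      ((hY k.succ).mono (ℱ.le _) le_rfl)
    obtain ⟨Y', hY', heq, hY'NA⟩ := ih _ (measurable_update hY hz) (h.update hzNA)
    refine ⟨Y', hY', fun r hr => ?_, hY'NA⟩
    have hlt : k.castSucc < r := Fin.castSucc_lt_succ.trans_le hr
    rw [heq r hlt.le, Function.update_of_ne hlt.ne']

/-- A reduction of an arbitrage-free price process at time `s` can be passed on to an earlier
time `t`. -/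
theorem ExtensionNAFrom.exists_lt [IsFiniteMeasure P] (hX : ∀ s, Measurable[ℱ s] (X s))
    (hY : ∀ r, Measurable[ℱ r] (Y r)) (hYNA : ExtensionNAFrom P ℱ X Y t) (s : Fin (T + 1)) :
    ∀ Y' : Fin (T + 1) → Ω → ℝ, (∀ r, Measurable[ℱ r] (Y' r)) → ExtensionNAFrom P ℱ X Y' s →
      t ≤ s → Y' s ≤ᵐ[P] Y s → ¬ Y' s =ᵐ[P] Y s →
      ∃ Y'' : Fin (T + 1) → Ω → ℝ, (∀ r, Measurable[ℱ r] (Y'' r)) ∧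
        ExtensionNAFrom P ℱ X Y'' t ∧ Y'' t ≤ᵐ[P] Y t ∧ ¬ Y'' t =ᵐ[P] Y t ∧
        Y'' (Fin.last T) = Y' (Fin.last T) := by
  induction s using Fin.induction with
  | zero =>
    intro Y' hY' h hts hle hne
    obtain rfl : t = 0 := le_antisymm hts (Fin.zero_le _)
    exact ⟨Y', hY', h, hle, hne, rfl⟩
  | succ k ih =>
    intro Y' hY' h hts hle hne
    rcases hts.eq_or_lt with rfl | hlt
    · exact ⟨Y', hY', h, hle, hne, rfl⟩
    · have htk : t ≤ k.castSucc := Fin.le_castSucc_iff.2 hlt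
      -- The unreduced process `Y` serves as the comparison at every date: its own price at `k` is
      -- the bound that the new one undercuts.
      obtain ⟨z, hz, hzNA, hzle, hzne⟩ := (hYNA k htk).exists_price_lt_of_lt (ℱ.le _)
        (measurable_increment hX k) ((hY k.succ).mono (ℱ.le _) le_rfl) (hY k.castSucc)
        ((hY' k.succ).mono (ℱ.le _) le_rfl) hle hne
      obtain ⟨Y'', h1, h2, h3, h4, h5⟩ := ih _ (measurable_update hY' hz) (h.update hzNA) htk
        (by rwa [Function.update_self]) (by rwa [Function.update_self])
      refine ⟨Y'', h1, h2, h3, h4, ?_⟩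
      rw [h5, Function.update_of_ne (Fin.castSucc_lt_last k).ne']

theorem sub_eq_sub_of_increments {y g : Fin (T + 1) → ℝ}
    (h : ∀ k : Fin T, t ≤ k.castSucc → y k.succ - y k.castSucc = g k.succ - g k.castSucc)
    (s : Fin (T + 1)) : t ≤ s → y s - y t = g s - g t := by
  induction s using Fin.induction with
  | zero =>
    intro hts
    obtain rfl : t = 0 := le_antisymm hts (Fin.zero_le _)
    simp
  | succ k ih =>
    intro hts
    rcases hts.eq_or_lt with rfl | hlt
    · simp
    · have htk : t ≤ k.castSucc := Fin.le_castSucc_iff.2 hlt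
      linarith [ih htk, h k htk]

/-- A claim whose price process is replicable in each period after time `t` is attainable. -/
theorem isAttainable_of_forall_replicable (hY : ∀ r, Measurable[ℱ r] (Y r))
    (hYH : Y (Fin.last T) =ᵐ[P] H)
    (h : ∀ k : Fin T, t ≤ k.castSucc → ∃ x : Ω → (Fin d → ℝ), Measurable[ℱ k.castSucc] x ∧
      ∀ᵐ ω ∂P, Y k.succ ω - Y k.castSucc ω = x ω ⬝ᵥ increment X k ω) :
    IsAttainable P ℱ X t H := by
  -- Periods before `t` receive the zero strategy, so that `choose` yields a strategy for all
  -- periods.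
  have h' : ∀ k : Fin T, ∃ x : Ω → (Fin d → ℝ), Measurable[ℱ k.castSucc] x ∧
      (t ≤ k.castSucc → ∀ᵐ ω ∂P, Y k.succ ω - Y k.castSucc ω = x ω ⬝ᵥ increment X k ω) := by
    intro k
    by_cases hk : t ≤ k.castSucc
    · obtain ⟨x, hx, hxY⟩ := h k hk
      exact ⟨x, hx, fun _ => hxY⟩
    · exact ⟨fun _ => 0, measurable_const, fun hk' => absurd hk' hk⟩
  choose ξ hξ hξY using h'
  refine ⟨ξ, Y t, hξ, hY t, ?_⟩
  have hall : ∀ᵐ ω ∂P, ∀ k : Fin T, t ≤ k.castSucc →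
      Y k.succ ω - Y k.castSucc ω = ξ k ω ⬝ᵥ increment X k ω :=
    ae_all_iff.2 fun k => by
      by_cases hk : t ≤ k.castSucc
      · filter_upwards [hξY k hk] with ω hω _ using hω
      · exact ae_of_all _ fun ω hk' => absurd hk' hk
  filter_upwards [hall, hYH] with ω hω hωH
  have := sub_eq_sub_of_increments (y := fun s => Y s ω) (g := fun s => gains X ξ s ω)
    (fun k hk => by rw [hω k hk, gains_succ]; ring) (Fin.last T) (Fin.le_last t)
  rw [gainsAfter, ← this, ← hωH]
  ring

/-- An arbitrage-free price of a claim that is not attainable can be lowered. -/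
theorem exists_arbitrageFreePrice_lt [IsFiniteMeasure P] (hX : ∀ s, Measurable[ℱ s] (X s))
    (hNA : IsArbitrageFree P ℱ X) (hH : ¬ IsAttainable P ℱ X t H)
    (hp : p ∈ arbitrageFreePrices P ℱ X t H) :
    ∃ q ∈ arbitrageFreePrices P ℱ X t H, q ≤ᵐ[P] p ∧ ¬ q =ᵐ[P] p := by
  obtain ⟨-, Y, hY, hYp, hYH, hYNA⟩ := hp
  rw [isArbitrageFree_extendMarket_iff hX hY] at hYNA
  have hex := mt (isAttainable_of_forall_replicable (X := X) (t := t) hY hYH) hH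
  simp only [not_forall] at hex
  obtain ⟨k, htk, hk⟩ := hex
  obtain ⟨z, hz, hzNA, hzle, hzne⟩ := (hYNA k (Fin.zero_le _)).exists_price_lt_of_not_replicable
    (ℱ.le _) (measurable_increment hX k) ((hY k.succ).mono (ℱ.le _) le_rfl) (hY k.castSucc)
    hk
  obtain ⟨Y₁, hY₁, hNA₁, hle, hne, hlast⟩ := (hYNA.mono (Fin.zero_le t)).exists_lt hX hY k.castSucc
    (Function.update Y k.castSucc z) (measurable_update hY hz)
    ((hYNA.mono (Fin.zero_le _)).update hzNA) htk
    (by rwa [Function.update_self]) (by rwa [Function.update_self])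
  rw [Function.update_of_ne (Fin.castSucc_lt_last k).ne'] at hlast
  -- The lowered price at `t` may be inconsistent with the old prices before `t`, so those are
  -- rebuilt by backward recursion.
  obtain ⟨Y₂, hY₂, heq, hNA₂⟩ := ExtensionNAFrom.exists_extension hX hNA t Y₁ hY₁ hNA₁
  refine ⟨Y₁ t, ⟨hY₁ t, Y₂, hY₂, by rw [heq t le_rfl], ?_,
    (isArbitrageFree_extendMarket_iff hX hY₂).2 hNA₂⟩, hle.trans_eq hYp,
    fun h => hne (h.trans hYp.symm)⟩
  rw [heq _ (Fin.le_last t), hlast]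
  exact hYH

theorem neg_mem_arbitrageFreePrices (hX : ∀ s, Measurable[ℱ s] (X s))
    (hp : p ∈ arbitrageFreePrices P ℱ X t H) :
    (fun ω => -p ω) ∈ arbitrageFreePrices P ℱ X t fun ω => -H ω := by
  obtain ⟨hpm, Y, hY, hYp, hYH, hYNA⟩ := hp
  have hYn : ∀ s, Measurable[ℱ s] fun ω => -Y s ω := fun s => (hY s).neg
  refine ⟨hpm.neg, fun s ω => -Y s ω, hYn, hYp.neg, hYH.neg, ?_⟩
  rw [isArbitrageFree_extendMarket_iff hX hYn]
  rw [isArbitrageFree_extendMarket_iff hX hY] at hYNA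
  intro k hk
  have := (hYNA k hk).addAsset_neg
  convert this using 3
  ring

theorem IsAttainable.neg (h : IsAttainable P ℱ X t H) :
    IsAttainable P ℱ X t fun ω => -H ω := by
  obtain ⟨ξ, Ht, hξ, hHt, heq⟩ := h
  refine ⟨fun k ω => -ξ k ω, fun ω => -Ht ω, fun k => (hξ k).neg, hHt.neg, ?_⟩
  filter_upwards [heq] with ω hω
  simp only [gainsAfter, gains, neg_dotProduct, Finset.sum_neg_distrib] at hω ⊢
  rw [hω]
  ring

/-- An arbitrage-free price of a claim that is not attainable can be raised. -/
theorem exists_arbitrageFreePrice_gt [IsFiniteMeasure P] (hX : ∀ s, Measurable[ℱ s] (X s))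
    (hNA : IsArbitrageFree P ℱ X) (hH : ¬ IsAttainable P ℱ X t H)
    (hp : p ∈ arbitrageFreePrices P ℱ X t H) :
    ∃ q ∈ arbitrageFreePrices P ℱ X t H, p ≤ᵐ[P] q ∧ ¬ q =ᵐ[P] p := by
  obtain ⟨q, hq, hle, hne⟩ := exists_arbitrageFreePrice_lt hX hNA
    (H := fun ω => -H ω) (t := t) (fun h => hH (by simpa using h.neg))
    (neg_mem_arbitrageFreePrices hX hp)
  refine ⟨fun ω => -q ω, by simpa using neg_mem_arbitrageFreePrices hX hq, ?_, fun h => hne ?_⟩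
  · filter_upwards [hle] with ω hω
    linarith
  · filter_upwards [h] with ω hω
    linarith

/-- No period starts at the final date, so the condition from there on is vacuous; the price process
is built backwards from the payoff. -/
theorem arbitrageFreePrices_nonempty [IsFiniteMeasure P] (hX : ∀ s, Measurable[ℱ s] (X s))
    (hNA : IsArbitrageFree P ℱ X) (t : Fin (T + 1)) (hH : Measurable[ℱ (Fin.last T)] H) :
    (arbitrageFreePrices P ℱ X t H).Nonempty := by
  obtain ⟨Y, hY, heq, hYNA⟩ := ExtensionNAFrom.exists_extension hX hNA (Fin.last T)
    (Function.update (fun _ _ => 0) (Fin.last T) H)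
    (measurable_update (fun _ => measurable_const) hH)
    (fun k hk => absurd (Fin.castSucc_lt_last k) hk.not_gt)
  refine ⟨Y t, hY t, Y, hY, Filter.EventuallyEq.rfl, ?_,
    (isArbitrageFree_extendMarket_iff hX hY).2 hYNA⟩
  rw [heq _ le_rfl, Function.update_self]

/-- The law of one price. -/
theorem eq_of_replicating_strategy {Ht : Ω → ℝ} (hξ : IsPredictable ℱ ξ)
    (hHt : Measurable[ℱ t] Ht) (hH : ∀ᵐ ω ∂P, H ω = Ht ω + gainsAfter X t ξ ω)
    (hp : p ∈ arbitrageFreePrices P ℱ X t H) : p =ᵐ[P] Ht := by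
  obtain ⟨hpm, Y, hY, hYp, hYH, hYNA⟩ := hp
  let c : Ω → ℝ := fun ω => p ω - Ht ω
  have hc : Measurable[ℱ t] c := hpm.sub hHt
  -- From `t` on, sell the claim and hold its replication, in `c` units each. The gain is `c * c`
  -- with `c = p - Ht`, so the factor `c` covers both signs of mispricing at once.
  let ζ : Fin T → Ω → (Fin (d + 1) → ℝ) := fun k ω =>
    if t ≤ k.castSucc then c ω • addAsset (ξ k) (fun _ => -1) ω else 0
  have hζ : IsPredictable ℱ ζ := fun k => by
    by_cases hk : t ≤ k.castSucc
    · simp only [ζ, if_pos hk]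
      exact Measurable.smul (hc.mono (ℱ.mono hk) le_rfl)
        (measurable_addAsset (hξ k) measurable_const)
    · simp only [ζ, if_neg hk]
      exact measurable_const
  have hζt : ∀ ω, gains (extendMarket X Y) ζ t ω = 0 := fun ω =>
    Finset.sum_eq_zero fun k hk => by
      have hkt : ¬ t ≤ k.castSucc :=
        (Fin.castSucc_lt_succ.trans_le (Finset.mem_filter.1 hk).2).not_ge
      simp only [ζ, if_neg hkt, zero_dotProduct]
  have hgain : ∀ᵐ ω ∂P, gains (extendMarket X Y) ζ (Fin.last T) ω = c ω * c ω := by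
    filter_upwards [hYp, hYH, hH] with ω h1 h2 h3
    have := sub_eq_sub_of_increments (t := t) (y := fun s => gains (extendMarket X Y) ζ s ω)
      (g := fun s => c ω * (gains X ξ s ω - Y s ω)) (fun k hk => by
        simp only [gains_succ, increment_extendMarket, ζ, if_pos hk, smul_dotProduct,
          addAsset_dotProduct_addAsset, smul_eq_mul]
        ring) (Fin.last T) (Fin.le_last t)
    simp only [hζt] at this
    rw [gainsAfter] at h3
    have h4 : gains X ξ (Fin.last T) ω - gains X ξ t ω - H ω + p ω = c ω := by
      simp only [c]
      linarith
    rw [h1, h2] at this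
    calc _ = c ω * (gains X ξ (Fin.last T) ω - gains X ξ t ω - H ω + p ω) := by linarith
      _ = _ := by rw [h4]
  have hz : P {ω | 0 < gains (extendMarket X Y) ζ (Fin.last T) ω} = 0 := by
    by_contra hne
    refine hYNA ⟨ζ, hζ, ?_, pos_iff_ne_zero.2 hne⟩
    filter_upwards [hgain] with ω hω
    rw [hω]
    exact mul_self_nonneg _
  filter_upwards [hgain, measure_eq_zero_iff_ae_notMem.1 hz] with ω h1 h2
  have h3 : ¬ 0 < c ω * c ω := fun h => h2 (show 0 < _ from h1 ▸ h)
  have h4 : c ω = 0 := mul_self_eq_zero.1 (le_antisymm (not_lt.1 h3) (mul_self_nonneg _))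
  exact sub_eq_zero.1 h4

end MultiPeriod

/-! ### The essential bounds of the price set -/

section PriceBounds

variable {Ω : Type*} {m : MeasurableSpace Ω} {P : Measure Ω} [IsProbabilityMeasure P] {T d : ℕ}
  {ℱ : Filtration (Fin (T + 1)) m} {X : Fin (T + 1) → Ω → (Fin d → ℝ)} {t : Fin (T + 1)}
  {H p : Ω → ℝ}

theorem priceInf_le (hp : p ∈ arbitrageFreePrices P ℱ X t H) :
    priceInf P ℱ X t H ≤ᵐ[P] fun ω => (p ω : EReal) :=
  (isEssInf_essInfFamily P _).le _ ⟨p, hp, rfl⟩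

theorem le_priceSup (hp : p ∈ arbitrageFreePrices P ℱ X t H) :
    (fun ω => (p ω : EReal)) ≤ᵐ[P] priceSup P ℱ X t H :=
  (isEssSup_essSupFamily P _).le _ ⟨p, hp, rfl⟩

theorem priceInf_eq_priceSup_of_unique (hp : p ∈ arbitrageFreePrices P ℱ X t H)
    (huniq : ∀ q ∈ arbitrageFreePrices P ℱ X t H, q =ᵐ[P] p) :
    priceInf P ℱ X t H =ᵐ[P] priceSup P ℱ X t H := by
  have hpm : Measurable fun ω => (p ω : EReal) :=
    measurable_coe_real_ereal.comp (hp.1.mono (ℱ.le t) le_rfl)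
  have h1 : (fun ω => (p ω : EReal)) ≤ᵐ[P] priceInf P ℱ X t H :=
    (isEssInf_essInfFamily P _).greatest _ hpm (by
      rintro _ ⟨q, hq, rfl⟩
      filter_upwards [huniq q hq] with ω hω
      rw [hω])
  have h2 : priceSup P ℱ X t H ≤ᵐ[P] fun ω => (p ω : EReal) :=
    (isEssSup_essSupFamily P _).least _ hpm (by
      rintro _ ⟨q, hq, rfl⟩
      filter_upwards [huniq q hq] with ω hω
      rw [hω])
  filter_upwards [h1, h2, priceInf_le hp, le_priceSup hp] with ω h3 h4 h5 h6
  exact le_antisymm (h5.trans h6) (h4.trans h3)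

/-- A price equal to the essential infimum would lie below every other price, so lowering it would
change nothing. -/
theorem not_isArbitrageFreePrice_priceInf (hX : ∀ s, Measurable[ℱ s] (X s))
    (hNA : IsArbitrageFree P ℱ X) (hH : ¬ IsAttainable P ℱ X t H) :
    ¬ IsArbitrageFreePrice P ℱ X t H (priceInf P ℱ X t H) := by
  rintro ⟨p, hp, hpe⟩
  obtain ⟨q, hq, hle, hne⟩ := exists_arbitrageFreePrice_lt hX hNA hH hp
  refine hne ?_
  filter_upwards [hle, hpe, priceInf_le hq] with ω h1 h2 h3
  rw [← h2] at h3
  exact le_antisymm h1 (EReal.coe_le_coe_iff.1 h3)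

theorem not_isArbitrageFreePrice_priceSup (hX : ∀ s, Measurable[ℱ s] (X s))
    (hNA : IsArbitrageFree P ℱ X) (hH : ¬ IsAttainable P ℱ X t H) :
    ¬ IsArbitrageFreePrice P ℱ X t H (priceSup P ℱ X t H) := by
  rintro ⟨p, hp, hpe⟩
  obtain ⟨q, hq, hle, hne⟩ := exists_arbitrageFreePrice_gt hX hNA hH hp
  refine hne ?_
  filter_upwards [hle, hpe, le_priceSup hq] with ω h1 h2 h3
  rw [← h2] at h3
  exact le_antisymm (EReal.coe_le_coe_iff.1 h3) h1

end PriceBounds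

end CondPricing

theorem mainTheorem2 {Ω : Type*} {m : MeasurableSpace Ω} (P : Measure Ω) [IsProbabilityMeasure P]
    (T d : ℕ) (ℱ : Filtration (Fin (T + 1)) m)
    (hℱ0 : ∀ A : Set Ω, MeasurableSet[ℱ 0] A → P A = 0 ∨ P A = 1)
    (hℱT : ℱ (Fin.last T) = m)
    (X : Fin (T + 1) → Ω → (Fin d → ℝ)) (hX : ∀ s, Measurable[ℱ s] (X s))
    (hNA : CondPricing.IsArbitrageFree P ℱ X)
    (t : Fin (T + 1)) (H : Ω → ℝ) (hH : Measurable H) (hH0 : 0 ≤ᵐ[P] H) :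
    (CondPricing.IsAttainable P ℱ X t H ↔
      CondPricing.priceInf P ℱ X t H =ᵐ[P] CondPricing.priceSup P ℱ X t H) ∧
    (CondPricing.IsAttainable P ℱ X t H ↔
      ∃ p ∈ CondPricing.arbitrageFreePrices P ℱ X t H,
        ∀ q ∈ CondPricing.arbitrageFreePrices P ℱ X t H, q =ᵐ[P] p) ∧
    (¬ CondPricing.IsAttainable P ℱ X t H →
      ¬ CondPricing.IsArbitrageFreePrice P ℱ X t H (CondPricing.priceInf P ℱ X t H) ∧
      ¬ CondPricing.IsArbitrageFreePrice P ℱ X t H (CondPricing.priceSup P ℱ X t H)) := by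
  obtain ⟨p, hp⟩ := CondPricing.arbitrageFreePrices_nonempty hX hNA t (hH.mono hℱT.ge le_rfl)
  have huniq : CondPricing.IsAttainable P ℱ X t H →
      ∀ q ∈ CondPricing.arbitrageFreePrices P ℱ X t H, q =ᵐ[P] p := by
    rintro ⟨ξ, Ht, hξ, hHt, hatt⟩ q hq
    exact (CondPricing.eq_of_replicating_strategy hξ hHt hatt hq).trans
      (CondPricing.eq_of_replicating_strategy hξ hHt hatt hp).symm
  refine ⟨⟨fun h => CondPricing.priceInf_eq_priceSup_of_unique hp (huniq h), fun h => ?_⟩,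
    ⟨fun h => ⟨p, hp, huniq h⟩, ?_⟩, fun h =>
      ⟨CondPricing.not_isArbitrageFreePrice_priceInf hX hNA h,
        CondPricing.not_isArbitrageFreePrice_priceSup hX hNA h⟩⟩
  -- When the bounds coincide, the price `p` is squeezed between them and so equals the lower one,
  -- which a non-attainable claim forbids.
  · by_contra hatt
    refine CondPricing.not_isArbitrageFreePrice_priceInf hX hNA hatt ⟨p, hp, ?_⟩
    filter_upwards [h, CondPricing.priceInf_le hp, CondPricing.le_priceSup hp] with ω h1 h2 h3
    exact le_antisymm (h1 ▸ h3) h2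
  · rintro ⟨q, hq, hall⟩
    by_contra hatt
    obtain ⟨r, hr, -, hne⟩ := CondPricing.exists_arbitrageFreePrice_lt hX hNA hatt hq
    exact hne (hall r hr)
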